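/- Let $k$ be a commutative ring and let $A$ be an associative unital $k$-algebra. Let $\Delta S$ be the category with objects $[n]=\{0,\dots,n\}$, $n\ge 0$, in which a morphism $[n]\to[m]$ is a map of sets together with a total order on each of its fibres (composed in the evident way), and let $B^{sym}_*A:\Delta S\to k\text{-}\mathbf{Mod}$ be the symmetric bar construction: $[n]\mapsto A^{\otimes (n+1)}$, where a morphism multiplies the tensor factors in each fibre in the given order and inserts $1_A$ for an empty fibre. The symmetric homology of $A$ is $HS_n(A\,|\,k)=\mathrm{Tor}_n^{\Delta S}(\underline{k},B^{sym}_*A)$, where $\underline k$ is the constant functor and $\mathrm{Tor}_n^{\Delta S}(-,B^{sym}_*A)$ is the $n$-th left derived functor of $-\otimes_{\Delta S}B^{sym}_*A$; for $n<0$ it is $0$. For a $k$-module $M$, $HS_n(A;M)=H_n(\mathscr{Y}_*A\otimes_k M)$, where $\mathscr{Y}_*A=k[N(-\setminus\Delta S)]\otimes_{\Delta S}B^{sym}_*A$ and $N(-\setminus\Delta S)$ is the nerve of the under-categories of $\Delta S$. **Theorem.** Let $A$ be flat over $k$ and let $B$ be a commutative $k$-algebra. There is a first quadrant homological spectral sequence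 (with $d^r:E^r_{p,q}\to E^r_{p-r,q+r-1}$, $r\ge 2$) $$E^2_{p,q}\cong\mathrm{Tor}^k_p\bigl(HS_q(A\,|\,k),B\bigr)\Longrightarrow HS_{p+q}(A;B),$$ that is, for every $n\geq 0$ there is a filtration $0=F_{-1}\subseteq F_0\subseteq\dots\subseteq F_n=HS_n(A;B)$ by submodules with $F_p/F_{p-1}\cong E^\infty_{p,n-p}$ for $0\le p\le n$. If moreover $k$ has weak global dimension $\le 1$ (that is, $\mathrm{Tor}^k_m(X,Y)=0$ for all $k$-modules $X,Y$ and all $m>1$), then this spectral sequence reduces to short exact sequences, for all $n\ge0$, $$0\to HS_n(A\,|\,k)\otimes_k B\to HS_n(A;B)\to \mathrm{Tor}^k_1\bigl(HS_{n-1}(A\,|\,k),B\bigr)\to 0,$$ in which the image of the first map is the step $F_0$ of the above filtration. (For $n=0$ this says that $HS_0(A\,|\,k)\otimes_kB\cong HS_0(A;B)$.) If in addition $k$ is hereditary (every submodule of a projective $k$-module is projective) and $A$ is projective over $k$, then these short exact sequences split. -/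

import Mathlib

open CategoryTheory CategoryTheory.Limits MonoidalCategory Opposite
open scoped TensorProduct DirectSum

universe u

noncomputable section

/-! ### Enough projectives in categories of functors -/

section EnoughProjectives

variable {C : Type} [SmallCategory C] {k : Type u} [CommRing k]

/-- Left adjoints of the evaluations send projective presentations of the values of `F` to a
projective presentation of `F`. -/
theorem enoughProjectives_functor : EnoughProjectives (C ⥤ ModuleCat.{u} k) where
  presentation F := by
    let P : C → (C ⥤ ModuleCat.{u} k) := fun c =>
      (evaluationLeftAdjoint (ModuleCat.{u} k) c).obj (Projective.over (F.obj c))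
    let φ : ∀ c, P c ⟶ F := fun c =>
      ((evaluationAdjunctionRight (ModuleCat.{u} k) c).homEquiv _ F).symm
        (Projective.π (F.obj c))
    have hP : ∀ c, Projective (P c) := fun c =>
      (evaluationAdjunctionRight (ModuleCat.{u} k) c).map_projective _ inferInstance
    have hepi : Epi (Limits.Sigma.desc φ) := by
      rw [NatTrans.epi_iff_epi_app]
      intro c
      have h : Projective.π (F.obj c) =
          ((evaluationAdjunctionRight (ModuleCat.{u} k) c).unit.app _ ≫
            (Limits.Sigma.ι P c).app c) ≫ (Limits.Sigma.desc φ).app c := by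
        rw [Category.assoc, ← NatTrans.comp_app, Limits.Sigma.ι_desc]
        have := (evaluationAdjunctionRight (ModuleCat.{u} k) c).homEquiv_unit
          (X := Projective.over (F.obj c)) (Y := F) (f := φ c)
        simp only [φ, Equiv.apply_symm_apply] at this
        exact this
      have : Epi (((evaluationAdjunctionRight (ModuleCat.{u} k) c).unit.app
            (Projective.over (F.obj c)) ≫
            (Limits.Sigma.ι P c).app c) ≫ (Limits.Sigma.desc φ).app c) := by
        rw [← h]; infer_instance
      exact epi_of_epi ((evaluationAdjunctionRight (ModuleCat.{u} k) c).unit.app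
            (Projective.over (F.obj c)) ≫ (Limits.Sigma.ι P c).app c) _
    have hproj : Projective (∐ P) := by
      refine ⟨fun f e _ => ⟨Limits.Sigma.desc fun c =>
        Projective.factorThru (Limits.Sigma.ι P c ≫ f) e, ?_⟩⟩
      ext1 c
      simp
    exact ⟨{ p := ∐ P, projective := hproj, f := Limits.Sigma.desc φ, epi := hepi }⟩

instance : EnoughProjectives (C ⥤ ModuleCat.{u} k) := enoughProjectives_functor

end EnoughProjectives

/-! ### Tensor product of functors -/

section CategoricalTensor

variable {C : Type} [SmallCategory C] {k : Type u} [CommRing k]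

open Classical in
/-- The submodule of `⨁ X, M(X) ⊗ N(X)` generated by the differences
`y ⊗ f_*(x) - f^*(y) ⊗ x` for `f : X ⟶ Y`, `x ∈ N(X)`, `y ∈ M(Y)`. -/
def tensorRelations (M : Cᵒᵖ ⥤ ModuleCat.{u} k) (N : C ⥤ ModuleCat.{u} k) :
    Submodule k (⨁ X : C, (M.obj (op X) ⊗[k] N.obj X)) :=
  Submodule.span k { z | ∃ (X Y : C) (f : X ⟶ Y) (x : N.obj X) (y : M.obj (op Y)),
    z = DirectSum.lof k C (fun X => M.obj (op X) ⊗[k] N.obj X) Y (y ⊗ₜ[k] (N.map f).hom x)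
      - DirectSum.lof k C (fun X => M.obj (op X) ⊗[k] N.obj X) X
          ((M.map f.op).hom y ⊗ₜ[k] x) }

/-- The map induced on `⨁ X, M(X) ⊗ N(X)` by a natural transformation in `M`. -/
def tensorSumMap {M M' : Cᵒᵖ ⥤ ModuleCat.{u} k} (η : M ⟶ M') (N : C ⥤ ModuleCat.{u} k) :
    (⨁ X : C, (M.obj (op X) ⊗[k] N.obj X)) →ₗ[k] (⨁ X : C, (M'.obj (op X) ⊗[k] N.obj X)) :=
  DirectSum.lmap (fun X => LinearMap.rTensor (N.obj X) (η.app (op X)).hom)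

theorem tensorRelations_le {M M' : Cᵒᵖ ⥤ ModuleCat.{u} k} (η : M ⟶ M')
    (N : C ⥤ ModuleCat.{u} k) :
    tensorRelations M N ≤ (tensorRelations M' N).comap (tensorSumMap η N) := by
  classical
  refine Submodule.span_le.2 ?_
  rintro _ ⟨X, Y, f, x, y, rfl⟩
  refine Submodule.subset_span ⟨X, Y, f, x, (η.app (op Y)).hom y, ?_⟩
  have h : (η.app (op X)).hom ((M.map f.op).hom y) =
      (M'.map f.op).hom ((η.app (op Y)).hom y) := by
    have := η.naturality f.op
    exact congrArg (fun g => g.hom y) this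
  simp only [tensorSumMap, map_sub, DirectSum.lmap_lof, LinearMap.rTensor_tmul, h]

/-- `M ↦ M ⊗_C N`, from contravariant functors on `C` to `k`-modules. -/
def tensorOver (N : C ⥤ ModuleCat.{u} k) : (Cᵒᵖ ⥤ ModuleCat.{u} k) ⥤ ModuleCat.{u} k where
  obj M := ModuleCat.of k ((⨁ X : C, (M.obj (op X) ⊗[k] N.obj X)) ⧸ tensorRelations M N)
  map η := ModuleCat.ofHom (Submodule.mapQ _ _ (tensorSumMap η N) (tensorRelations_le η N))
  map_id M := by
    classical
    ext : 1
    refine Submodule.linearMap_qext _ (DirectSum.linearMap_ext _ fun X => ?_)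
    refine TensorProduct.ext' fun y x => ?_
    simp [tensorSumMap]
  map_comp η θ := by
    classical
    ext : 1
    refine Submodule.linearMap_qext _ (DirectSum.linearMap_ext _ fun X => ?_)
    refine TensorProduct.ext' fun y x => ?_
    simp [tensorSumMap, DirectSum.lmap_lof]

instance (N : C ⥤ ModuleCat.{u} k) : (tensorOver N).Additive where
  map_add := by
    classical
    intro M M' η θ
    ext : 1
    refine Submodule.linearMap_qext _ (DirectSum.linearMap_ext _ fun X => ?_)
    refine TensorProduct.ext' fun y x => ?_
    have h : tensorSumMap (η + θ) N = tensorSumMap η N + tensorSumMap θ N := by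
      refine DirectSum.linearMap_ext _ fun X => TensorProduct.ext' fun y x => ?_
      simp [tensorSumMap, DirectSum.lmap_lof]
    exact congrArg (fun g => (tensorRelations M' N).mkQ
      (g (DirectSum.lof k C (fun X => M.obj (op X) ⊗[k] N.obj X) X (y ⊗ₜ[k] x)))) h

end CategoricalTensor

/-! ### The category `ΔS` and the symmetric bar construction -/

/-- The objects `[n] = {0, …, n}`, `n ≥ 0`, of `ΔS`. -/
structure DeltaS : Type where
  n : ℕ

/-- A morphism `[n] ⟶ [m]` of `ΔS` in tensor notation `X_0 ⊗ ⋯ ⊗ X_m`: monomials `X_i` in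
noncommuting variables `x_0, …, x_n` such that each variable occurs exactly once in the whole
expression; equivalently, a map of sets `[n] → [m]` with a total order on each fibre (the word
`X_i` lists the fibre over `i` in its order). -/
@[ext]
structure DeltaS.Hom (a b : DeltaS) : Type where
  word : Fin (b.n + 1) → List (Fin (a.n + 1))
  once : ∀ j, ∑ i, (word i).count j = 1

theorem DeltaS.sum_map_eq_sum_count {ι : Type} [Fintype ι] [DecidableEq ι] (l : List ι)
    (f : ι → ℕ) : (l.map f).sum = ∑ x, l.count x * f x := by
  induction l with
  | nil => simp
  | cons a l ih =>
    simp [ih, List.count_cons, add_mul, Finset.sum_add_distrib, add_comm]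

/-- Composition substitutes the words of the first morphism for the variables of the second. -/
instance : SmallCategory DeltaS where
  Hom := DeltaS.Hom
  id a := ⟨fun i => [i], fun j => by simp [List.count_singleton]⟩
  comp {a b c} β α := ⟨fun i => (α.word i).flatMap β.word, fun j => by
    have h : ∀ i, ((α.word i).flatMap β.word).count j =
        ∑ x, (α.word i).count x * (β.word x).count j := fun i => by
      rw [List.count_flatMap, ← DeltaS.sum_map_eq_sum_count]
      rfl
    simp only [h]
    rw [Finset.sum_comm]
    simp only [← Finset.sum_mul, α.once, one_mul, β.once]⟩
  id_comp f := by
    apply DeltaS.Hom.ext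
    funext i
    simp
  comp_id f := by
    apply DeltaS.Hom.ext
    funext i
    simp
  assoc f g h := by
    apply DeltaS.Hom.ext
    funext i
    simp [List.flatMap_assoc]

theorem DeltaS.Hom.exists_factor {a b : DeltaS} (α : DeltaS.Hom a b) (j : Fin (a.n + 1)) :
    ∃ i₀ l₁ l₂, α.word i₀ = l₁ ++ j :: l₂ ∧ j ∉ l₁ ∧ j ∉ l₂ ∧ ∀ i, i ≠ i₀ → j ∉ α.word i := by
  have h := α.once j
  obtain ⟨i₀, -, h0⟩ := Finset.exists_ne_zero_of_sum_ne_zero (h.trans_ne one_ne_zero)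
  rw [← Finset.add_sum_erase _ _ (Finset.mem_univ i₀)] at h
  have h1 : (α.word i₀).count j = 1 := by omega
  have h2 : ∑ i ∈ Finset.univ.erase i₀, (α.word i).count j = 0 := by omega
  obtain ⟨l₁, l₂, hl⟩ := List.append_of_mem (List.count_pos_iff.1 (h1.symm ▸ Nat.one_pos))
  rw [hl, List.count_append, List.count_cons_self] at h1
  refine ⟨i₀, l₁, l₂, hl, List.count_eq_zero.1 (by omega), List.count_eq_zero.1 (by omega),
    fun i hi => List.count_eq_zero.1 ?_⟩
  exact Finset.sum_eq_zero_iff.1 h2 i (Finset.mem_erase.2 ⟨hi, Finset.mem_univ _⟩)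

section SymmetricBar

variable (k : Type u) [CommRing k] (A : Type u) [Ring A] [Algebra k A]

theorem DeltaS.Hom.exists_update {a b : DeltaS} (α : DeltaS.Hom a b) (j : Fin (a.n + 1))
    (v : Fin (a.n + 1) → A) :
    ∃ i₀ P Q, ∀ x, (fun i => ((α.word i).map (Function.update v j x)).prod) =
      Function.update (fun i => ((α.word i).map v).prod) i₀ (P * (x * Q)) := by
  obtain ⟨i₀, l₁, l₂, h0, h1, h2, h3⟩ := α.exists_factor j
  have key : ∀ (l : List (Fin (a.n + 1))) (x : A), j ∉ l →
      l.map (Function.update v j x) = l.map v := fun l x hl =>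
    List.map_congr_left fun i hi => Function.update_of_ne (ne_of_mem_of_not_mem hi hl) _ _
  refine ⟨i₀, (l₁.map v).prod, (l₂.map v).prod, fun x => funext fun i => ?_⟩
  by_cases hi : i = i₀
  · subst hi
    simp [h0, key _ _ h1, key _ _ h2]
  · rw [Function.update_of_ne hi, key _ _ (h3 i hi)]

/-- The evaluation `(a_0, …, a_n) ↦ X_0(a) ⊗ ⋯ ⊗ X_m(a)` of a morphism of `ΔS`; an empty
monomial gives the unit of `A`. -/
def symBarMultilinear {a b : DeltaS} (α : a ⟶ b) :
    MultilinearMap k (fun _ : Fin (a.n + 1) => A) (⨂[k] _ : Fin (b.n + 1), A) where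
  toFun v := PiTensorProduct.tprod k
    (fun i => ((DeltaS.Hom.word α i).map v).prod)
  map_update_add' {inst} v j x y := by
    obtain rfl := Subsingleton.elim inst (instDecidableEqFin _)
    obtain ⟨i₀, P, Q, h⟩ := DeltaS.Hom.exists_update A α j v
    simp only [h]
    rw [add_mul, mul_add, MultilinearMap.map_update_add]
  map_update_smul' {inst} v j c x := by
    obtain rfl := Subsingleton.elim inst (instDecidableEqFin _)
    obtain ⟨i₀, P, Q, h⟩ := DeltaS.Hom.exists_update A α j v
    simp only [h]
    rw [smul_mul_assoc, mul_smul_comm, MultilinearMap.map_update_smul]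

/-- The symmetric bar construction `[n] ↦ A^{⊗(n+1)}`. -/
def symBar : DeltaS ⥤ ModuleCat.{u} k where
  obj a := ModuleCat.of k (⨂[k] _ : Fin (a.n + 1), A)
  map α := ModuleCat.ofHom (PiTensorProduct.lift (symBarMultilinear k A α))
  map_id a := by
    ext : 1
    refine PiTensorProduct.ext (MultilinearMap.ext fun v => ?_)
    have h : ∀ i, ((DeltaS.Hom.word (𝟙 a) i).map v).prod = v i := fun i => by
      change ([i].map v).prod = v i
      simp
    simp [symBarMultilinear, h]
  map_comp {a b c} β α := by
    ext : 1
    refine PiTensorProduct.ext (MultilinearMap.ext fun v => ?_)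
    have h : ∀ i, ((DeltaS.Hom.word (β ≫ α) i).map v).prod =
        ((DeltaS.Hom.word α i).map
          (fun j => ((DeltaS.Hom.word β j).map v).prod)).prod := fun i => by
      change (((DeltaS.Hom.word α i).flatMap (DeltaS.Hom.word β)).map v).prod = _
      generalize DeltaS.Hom.word α i = l
      induction l with
      | nil => rfl
      | cons j l ih =>
        rw [List.flatMap_cons, List.map_append, List.prod_append, ih, List.map_cons,
          List.prod_cons]
    simp [symBarMultilinear, h]

end SymmetricBar

/-! ### Symmetric homology -/

section SymmetricHomology

variable (k : Type u) [CommRing k]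

/-- The simplicial `ΔSᵒᵖ`-module `k[N(- \ ΔS)]`. -/
def standardSimplicial : SimplicialObject (DeltaSᵒᵖ ⥤ ModuleCat.{u} k) :=
  Functor.flip (Under.mapFunctor DeltaS ⋙ nerveFunctor ⋙
    (SimplicialObject.whiskering _ _).obj (uliftFunctor.{u, 0} ⋙ ModuleCat.free k))

/-- The complex of `ΔSᵒᵖ`-modules `k[N(- \ ΔS)]`, with differential `∑ (-1)^i d_i`. -/
def standardResolution : ChainComplex (DeltaSᵒᵖ ⥤ ModuleCat.{u} k) ℕ :=
  (AlgebraicTopology.alternatingFaceMapComplex _).obj (standardSimplicial k)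

variable (A : Type u) [Ring A] [Algebra k A]

/-- `HS_n(A | k) = Tor_n^{ΔS}(k, B^{sym} A)`: the left derived functors of `- ⊗_{ΔS} B^{sym} A`
at the trivial `ΔSᵒᵖ`-module. -/
def HS (n : ℕ) : ModuleCat.{u} k :=
  ((tensorOver (symBar k A)).leftDerived n).obj
    ((Functor.const DeltaSᵒᵖ).obj (ModuleCat.of k k))

/-- The complex `k[N(- \ ΔS)] ⊗_{ΔS} B^{sym} A`. -/
def symComplex : ChainComplex (ModuleCat.{u} k) ℕ :=
  ((tensorOver (symBar k A)).mapHomologicalComplex _).obj (standardResolution k)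

/-- `HS_n(A; M)`, the symmetric homology of `A` over `k` with coefficients in `M`. -/
def HSCoeff (M : ModuleCat.{u} k) (n : ℕ) : ModuleCat.{u} k :=
  (((tensorRight M).mapHomologicalComplex _).obj (symComplex k A)).homology n

end SymmetricHomology

/-! ### Convergent first quadrant spectral sequences -/

section Convergence

variable (k : Type u) [CommRing k]

/-- First quadrant homological spectral sequences of `k`-modules starting at `E²`, with
differentials `d^r : E^r_{p,q} ⟶ E^r_{p-r,q+r-1}`. -/
abbrev HomologicalE2 : Type (u + 1) :=
  SpectralSequence (ModuleCat.{u} k)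
    (fun r => ComplexShape.spectralSequenceNat ((-r, r - 1) : ℤ × ℤ)) 2

variable {k}

/-- Convergence `E ⇒ H`: finite increasing filtrations `0 = F_{-1} ⊆ F_0 ⊆ ⋯ ⊆ F_n = H_n`
and identifications of `F_p H_{p+q} / F_{p-1} H_{p+q}` with `E^∞_{p,q}`.  Here `E^∞_{p,q}` is the
stable value of `E^r_{p,q}`, which is attained as soon as `r > p` and `r > q + 1`, since from then
on the differentials into and out of the position `(p,q)` leave the first quadrant. -/
structure Convergence (E : HomologicalE2 k) (H : ℕ → ModuleCat.{u} k) where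
  F : ∀ n : ℕ, ℤ → Submodule k (H n)
  mono : ∀ n, Monotone (F n)
  bot : ∀ n, F n (-1) = ⊥
  top : ∀ n, F n n = ⊤
  gr : ∀ (p q : ℕ) (r : ℤ) (hr : 2 ≤ r), (p : ℤ) < r → (q : ℤ) + 1 < r →
    ((F (p + q) p ⧸ (F (p + q) (p - 1)).submoduleOf (F (p + q) p)) ≃ₗ[k] (E.page r hr).X (p, q))

end Convergence

/-! ### Homological conditions on the ground ring -/

section Rings

variable (k : Type u) [CommRing k]

/-- `k` has weak global dimension `≤ n`: `Tor_m(X, Y) = 0` for all `X`, `Y` and `m > n`. -/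
def HasWeakGlobalDimensionLE (n : ℕ) : Prop :=
  ∀ (X Y : ModuleCat.{u} k) (m : ℕ), n < m →
    IsZero (((Tor (ModuleCat.{u} k) m).obj X).obj Y)

/-- `k` is hereditary: submodules of projective modules are projective. -/
def IsHereditaryRing : Prop :=
  ∀ (P : Type u) [AddCommGroup P] [Module k P], Module.Projective k P →
    ∀ N : Submodule k P, Module.Projective k N

end Rings

end

/-! Write Y for `symComplex`, that is k[N(- \ ΔS)] ⊗ B^sym A. Each X is initial in X \ ΔS, so the
nerves have an extra degeneracy and k[N(- \ ΔS)] resolves the constant functor. By Yoneda its terms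
are projective: a map out of one is given by arbitrary values on the canonical lifts of strings of
arrows. Hence HS_q(A | k) = H_q(Y) (`nonempty_HS_iso`). Moreover Y_n is a retract of a direct sum of
tensor powers of A (`exists_retract_tensorOver`), so it is flat, or projective, whenever A is.

What remains is a universal coefficient theorem for Y. Take a projective resolution P → B and filter
the total complex of Y ⊗ P by the degree in P. Flatness of P_p gives E¹ = H_q(Y) ⊗ P_p, hence E² =
Tor_p(H_q(Y), B) (`TotalTensor.nonempty_E_two_equiv`). Flatness of Y_q makes Y_q ⊗ (B ← P) exact, so
the augmented total complex is acyclic (`TotalTensor.exists_d_eq`); this identifies the abutment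
with the homology of Y ⊗ B (`TotalTensor.exists_convergence`). The pages are the classical quotients
of Z^r by B^r, and `FilteredDifferential.homologyEquiv` passes from one page to the next.

Weak global dimension at most 1 kills the columns p ≥ 2, so the filtration has two steps, which is a
short exact sequence. Over a hereditary ring with A projective, the boundaries in Y_{n-1} are
projective, so the cycles Z_n split off Y_n and the class map Z_n → H_n(Y) extends to Y_n. Tensoring
the extension with B gives a map H_n(Y ⊗ B) → H_n(Y) ⊗ B. The left map of the sequence comes from
the filtration and is not compared with the canonical one; knowing that its image F_0 is the image
of Z_n(Y) ⊗ B is enough to split it (`ChainComplex.nonempty_splitting`). -/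

noncomputable section

/-! ### Homology of complexes of modules by cycles and boundaries -/

section HomologyClasses

variable {k : Type u} [CommRing k]

/-- The homology class of a cycle in a short complex of modules. -/
def CategoryTheory.ShortComplex.moduleCatClass (S : ShortComplex (ModuleCat.{u} k)) :
    LinearMap.ker S.g.hom →ₗ[k] S.homology :=
  (S.moduleCatLeftHomologyData.π ≫ S.moduleCatHomologyIso.inv).hom

theorem CategoryTheory.ShortComplex.moduleCatClass_surjective
    (S : ShortComplex (ModuleCat.{u} k)) : Function.Surjective S.moduleCatClass :=
  (ModuleCat.epi_iff_surjective (S.moduleCatLeftHomologyData.π ≫ S.moduleCatHomologyIso.inv)).1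
    inferInstance

theorem CategoryTheory.ShortComplex.moduleCatClass_eq_zero_iff
    (S : ShortComplex (ModuleCat.{u} k)) (z : LinearMap.ker S.g.hom) :
    S.moduleCatClass z = 0 ↔ ∃ y : S.X₁, S.f.hom y = z := by
  have hinj : Function.Injective S.moduleCatHomologyIso.inv.hom :=
    (ModuleCat.mono_iff_injective S.moduleCatHomologyIso.inv).1 inferInstance
  have h : S.moduleCatClass z = S.moduleCatHomologyIso.inv.hom
      (Submodule.Quotient.mk (p := LinearMap.range S.moduleCatToCycles) z) := rfl
  rw [h]
  refine ((map_eq_zero_iff _ hinj).trans (Submodule.Quotient.mk_eq_zero _)).trans ?_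
  constructor
  · rintro ⟨y, hy⟩
    exact ⟨y, congrArg Subtype.val hy⟩
  · rintro ⟨y, hy⟩
    exact ⟨y, Subtype.ext hy⟩

/-- A linear map onto the cycles modulo boundaries identifies the homology with a quotient. -/
def CategoryTheory.ShortComplex.moduleCatHomologyEquiv (S : ShortComplex (ModuleCat.{u} k))
    {W : Type u} [AddCommGroup W] [Module k W] (φ : W →ₗ[k] S.X₂) (N : Submodule k W)
    (h0 : ∀ w, S.g.hom (φ w) = 0)
    (h1 : ∀ x, S.g.hom x = 0 → ∃ w y, x = φ w + S.f.hom y)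
    (h2 : ∀ w, w ∈ N ↔ ∃ y, S.f.hom y = φ w) : (W ⧸ N) ≃ₗ[k] S.homology := by
  let ψ : W →ₗ[k] S.homology := S.moduleCatClass ∘ₗ φ.codRestrict (LinearMap.ker S.g.hom) h0
  have hψ : Function.Surjective ψ := by
    intro c
    obtain ⟨⟨x, hx⟩, rfl⟩ := S.moduleCatClass_surjective c
    obtain ⟨w, y, rfl⟩ := h1 x hx
    refine ⟨w, ?_⟩
    rw [← sub_eq_zero]
    refine (map_sub S.moduleCatClass (φ.codRestrict (LinearMap.ker S.g.hom) h0 w)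
      ⟨_, hx⟩).symm.trans ((S.moduleCatClass_eq_zero_iff _).2 ⟨-y, ?_⟩)
    change S.f.hom (-y) = φ w - (φ w + S.f.hom y)
    rw [map_neg]; abel
  have hN : N = LinearMap.ker ψ := by
    ext w
    rw [h2, LinearMap.mem_ker]
    exact (S.moduleCatClass_eq_zero_iff (φ.codRestrict (LinearMap.ker S.g.hom) h0 w)).symm
  exact (Submodule.quotEquivOfEq _ _ hN).trans (LinearMap.quotKerEquivOfSurjective ψ hψ)

/-- With truncated subtraction this includes n = 0, where `d 0 0` vanishes; so the kernel of `d n (n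
- 1)` is the module of cycles in every degree, without a case distinction. -/
theorem ChainComplex.next_eq_sub_one (n : ℕ) : (ComplexShape.down ℕ).next n = n - 1 := by
  cases n <;> simp

/-- The homology class of a cycle of a chain complex of modules. -/
def ChainComplex.homologyClass (K : ChainComplex (ModuleCat.{u} k) ℕ) (n : ℕ) :
    LinearMap.ker (K.d n (n - 1)).hom →ₗ[k] K.homology n :=
  (K.sc n).moduleCatClass ∘ₗ LinearMap.codRestrict (LinearMap.ker (K.sc n).g.hom)
    (LinearMap.ker (K.d n (n - 1)).hom).subtype (fun x => by
      have hx := x.2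
      have h : ∀ m, m = n - 1 → (K.d n m).hom x.1 = 0 := by rintro m rfl; exact hx
      exact h _ (ChainComplex.next_eq_sub_one n))

theorem ChainComplex.homologyClass_surjective (K : ChainComplex (ModuleCat.{u} k) ℕ) (n : ℕ) :
    Function.Surjective (K.homologyClass n) := by
  intro c
  obtain ⟨⟨x, hx⟩, rfl⟩ := (K.sc n).moduleCatClass_surjective c
  have h : ∀ m, m = n - 1 → (K.d n m).hom x = 0 → (K.d n (n - 1)).hom x = 0 := by
    rintro m rfl h; exact h
  exact ⟨⟨x, h _ (ChainComplex.next_eq_sub_one n) hx⟩, rfl⟩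

theorem ChainComplex.homologyClass_eq_zero_iff (K : ChainComplex (ModuleCat.{u} k) ℕ) (n : ℕ)
    (z : LinearMap.ker (K.d n (n - 1)).hom) :
    K.homologyClass n z = 0 ↔ ∃ y : K.X (n + 1), (K.d (n + 1) n).hom y = z := by
  refine ((K.sc n).moduleCatClass_eq_zero_iff _).trans ?_
  have h : ∀ m, m = n + 1 → ((∃ y : K.X m, (K.d m n).hom y = z) ↔
      ∃ y : K.X (n + 1), (K.d (n + 1) n).hom y = z) := by rintro m rfl; rfl
  exact h _ (ChainComplex.prev ℕ n)

end HomologyClasses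

/-! ### The spectral sequence of a filtered module with differential -/

/-- A module with a differential `d`, and a filtration `F p n` (filtration degree `p`, homological
degree `n`) which is concentrated in the first quadrant. -/
structure FilteredDifferential (k : Type u) [CommRing k] (M : Type u) [AddCommGroup M]
    [Module k M] where
  d : M →ₗ[k] M
  F : ℤ → ℤ → Submodule k M
  d_d : ∀ x, d (d x) = 0
  mono : ∀ n, Monotone fun p => F p n
  d_mem : ∀ {p n x}, x ∈ F p n → d x ∈ F p (n - 1)
  bot : ∀ {p n}, p < 0 → F p n = ⊥
  top : ∀ {p n}, n ≤ p → F p n ≤ F n n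

namespace FilteredDifferential

variable {k : Type u} [CommRing k] {M : Type u} [AddCommGroup M] [Module k M]
  (D : FilteredDifferential k M)

theorem mem_of_le {p p' n : ℤ} (h : p ≤ p') {x : M} (hx : x ∈ D.F p n) : x ∈ D.F p' n :=
  D.mono n h hx

theorem eq_zero_of_mem {p n : ℤ} (hp : p < 0) {x : M} (hx : x ∈ D.F p n) : x = 0 := by
  rw [D.bot hp] at hx; exact (Submodule.mem_bot k).1 hx

/-- The filtration is exhausted at p = n, so any bound p' ≥ n is available, even one below p. -/
theorem mem_of_mem {p p' n : ℤ} (h : n ≤ p') {x : M} (hx : x ∈ D.F p n) : x ∈ D.F p' n := by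
  rcases le_total p p' with h' | h'
  · exact D.mem_of_le h' hx
  · exact D.mem_of_le h (D.top (h.trans h') hx)

/-- Elements of filtration `p` whose differential has filtration `p - r`. -/
def Z (r p n : ℤ) : Submodule k M := D.F p n ⊓ (D.F (p - r) (n - 1)).comap D.d

/-- The submodule of `Z r p n` which is divided out on the `r`-th page. -/
def B (r p n : ℤ) : Submodule k M :=
  (D.Z (r - 1) (p + r - 1) (n + 1)).map D.d ⊔ D.Z (r - 1) (p - 1) n

theorem mem_Z {r p n : ℤ} {x : M} : x ∈ D.Z r p n ↔ x ∈ D.F p n ∧ D.d x ∈ D.F (p - r) (n - 1) :=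
  Iff.rfl

theorem mem_B {r p n : ℤ} {x : M} : x ∈ D.B r p n ↔
    ∃ y ∈ D.Z (r - 1) (p + r - 1) (n + 1), ∃ z ∈ D.Z (r - 1) (p - 1) n, D.d y + z = x := by
  simp [B, Submodule.mem_sup]

/-- The term of the `r`-th page in filtration degree `p` and homological degree `n`. -/
abbrev E (r p n : ℤ) : Type u := D.Z r p n ⧸ (D.B r p n).submoduleOf (D.Z r p n)

theorem d_mem_Z {r p n p' n' : ℤ} (hp : p' = p - r) (hn : n' = n - 1) {x : M}
    (hx : x ∈ D.Z r p n) : D.d x ∈ D.Z r p' n' := by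
  subst hp hn
  exact ⟨hx.2, by simp [D.d_d]⟩

/-- In dy + z the first summand dies, and z has exactly the filtration needed to make dz one of the
boundaries at the target. -/
theorem d_mem_B {r p n p' n' : ℤ} (hp : p' = p - r) (hn : n' = n - 1) {x : M}
    (hx : x ∈ D.B r p n) : D.d x ∈ D.B r p' n' := by
  subst hp hn
  obtain ⟨y, hy, z, hz, rfl⟩ := D.mem_B.1 hx
  refine D.mem_B.2 ⟨z, ?_, 0, zero_mem _, by simp [D.d_d]⟩
  rw [show p - r + r - 1 = p - 1 by ring, sub_add_cancel]
  exact hz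

/-- The differential of the `r`-th page. -/
def diff {r p n p' n' : ℤ} (hp : p' = p - r) (hn : n' = n - 1) : D.E r p n →ₗ[k] D.E r p' n' :=
  Submodule.mapQ _ _ (D.d.restrict fun x hx => D.d_mem_Z (x := x) hp hn hx)
    fun _ hx => D.d_mem_B hp hn hx

/-- The `r`-th page. -/
def page (r : ℤ) : HomologicalComplex (ModuleCat.{u} k)
    (ComplexShape.spectralSequenceNat ((-r, r - 1) : ℤ × ℤ)) where
  X pq := ModuleCat.of k (D.E r pq.1 (pq.1 + pq.2))
  d a b := by
    classical
    exact if h : (ComplexShape.spectralSequenceNat ((-r, r - 1) : ℤ × ℤ)).Rel a b then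
      ModuleCat.ofHom (D.diff (by have := h.1; dsimp at this; lia)
        (by have h1 := h.1; have h2 := h.2; dsimp at h1 h2; lia)) else 0
  shape a b h := dif_neg h
  d_comp_d' a b c hab hbc := by
    classical
    rw [dif_pos hab, dif_pos hbc, ← ModuleCat.ofHom_comp]
    ext : 1
    refine Submodule.linearMap_qext _ (LinearMap.ext fun x => ?_)
    refine (Submodule.Quotient.mk_eq_zero _).2 ?_
    change D.d (D.d x.1) ∈ D.B r c.1 (c.1 + c.2)
    rw [D.d_d]
    exact zero_mem _

theorem page_d {r : ℤ} {a b : ℕ × ℕ}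
    (h : (ComplexShape.spectralSequenceNat ((-r, r - 1) : ℤ × ℤ)).Rel a b)
    (hp : (b.1 : ℤ) = a.1 - r) (hn : (b.1 + b.2 : ℤ) = a.1 + a.2 - 1) :
    (D.page r).d a b = ModuleCat.ofHom (D.diff hp hn) := dif_pos h

variable {r : ℤ} (hr : 2 ≤ r) (a : ℕ × ℕ)

-- When p - r is negative the position has no target on the page; both sides then hold, since dx
-- lies in a zero step of the filtration.
include hr in
theorem page_sc_g_mk_eq_zero_iff (x : D.Z r a.1 (a.1 + a.2)) :
    ((D.page r).sc a).g.hom (Submodule.Quotient.mk x) = 0 ↔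
      D.d x ∈ D.B r (a.1 - r) (a.1 + a.2 - 1) := by
  by_cases h : ∃ b, (ComplexShape.spectralSequenceNat ((-r, r - 1) : ℤ × ℤ)).Rel a b
  · obtain ⟨b, hb⟩ := h
    have key : ∀ c, c = b → (((D.page r).d a c).hom (Submodule.Quotient.mk x) = 0 ↔
        D.d x ∈ D.B r (a.1 - r) (a.1 + a.2 - 1)) := by
      rintro c rfl
      have h1 := hb.1
      have h2 := hb.2
      dsimp at h1 h2
      have hp : (c.1 : ℤ) = a.1 - r := by lia
      have hn : (c.1 + c.2 : ℤ) = a.1 + a.2 - 1 := by lia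
      rw [D.page_d hb hp hn]
      refine (Submodule.Quotient.mk_eq_zero _).trans ?_
      change D.d x.1 ∈ D.B r c.1 (c.1 + c.2) ↔ _
      rw [hp, ← hn, hp]
    exact key _ ((ComplexShape.spectralSequenceNat _).next_eq' hb)
  · have hneg : (a.1 : ℤ) - r < 0 := by
      by_contra hcon
      refine h ⟨((a.1 - r : ℤ).toNat, (a.2 + r - 1 : ℤ).toNat), ?_, ?_⟩ <;> dsimp <;> lia
    have h0 : ((D.page r).sc a).g = 0 := (D.page r).shape _ _ fun hc => h ⟨_, hc⟩
    have hx : D.d x.1 = 0 := D.eq_zero_of_mem hneg x.2.2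
    have h1 : ((D.page r).sc a).g.hom (Submodule.Quotient.mk x) = 0 := by rw [h0]; rfl
    exact iff_of_true h1 (by rw [hx]; exact zero_mem _)

-- When q - r + 1 is negative there is no source. The differentials dz are then already in B: z has
-- total degree p + q + 1 ≤ p + r - 1, so its filtration is at most p + r - 1.
include hr in
theorem exists_page_sc_f_eq_mk_iff (w : D.Z r a.1 (a.1 + a.2)) :
    (∃ y, ((D.page r).sc a).f.hom y = Submodule.Quotient.mk w) ↔
      ∃ z ∈ D.Z r (a.1 + r) (a.1 + a.2 + 1), (w : M) - D.d z ∈ D.B r a.1 (a.1 + a.2) := by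
  by_cases h : ∃ b, (ComplexShape.spectralSequenceNat ((-r, r - 1) : ℤ × ℤ)).Rel b a
  · obtain ⟨b, hb⟩ := h
    have key : ∀ c, c = b → ((∃ y, ((D.page r).d c a).hom y = Submodule.Quotient.mk w) ↔
        ∃ z ∈ D.Z r (a.1 + r) (a.1 + a.2 + 1), (w : M) - D.d z ∈ D.B r a.1 (a.1 + a.2)) := by
      rintro c rfl
      have h1 := hb.1
      have h2 := hb.2
      dsimp at h1 h2
      have hp : (a.1 : ℤ) = c.1 - r := by lia
      have hn : (a.1 + a.2 : ℤ) = c.1 + c.2 - 1 := by lia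
      have e1 : (a.1 : ℤ) + r = c.1 := by lia
      have e2 : (a.1 + a.2 : ℤ) + 1 = c.1 + c.2 := by lia
      rw [D.page_d hb hp hn, e1, e2]
      constructor
      · rintro ⟨y, hy⟩
        obtain ⟨z, rfl⟩ := Submodule.Quotient.mk_surjective _ y
        exact ⟨z.1, z.2, (Submodule.Quotient.eq ((D.B r a.1 (a.1 + a.2)).submoduleOf _)).1 hy.symm⟩
      · rintro ⟨z, hz, hzw⟩
        exact ⟨Submodule.Quotient.mk ⟨z, hz⟩,
          ((Submodule.Quotient.eq ((D.B r a.1 (a.1 + a.2)).submoduleOf _)).2 hzw).symm⟩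
    exact key _ ((ComplexShape.spectralSequenceNat _).prev_eq' hb)
  · have hneg : (a.2 : ℤ) - r + 1 < 0 := by
      by_contra hcon
      refine h ⟨((a.1 + r : ℤ).toNat, (a.2 - r + 1 : ℤ).toNat), ?_, ?_⟩ <;> dsimp <;> lia
    have h0 : ((D.page r).sc a).f = 0 := (D.page r).shape _ _ fun hc => h ⟨_, hc⟩
    have hB : ∀ z ∈ D.Z r (a.1 + r) (a.1 + a.2 + 1), D.d z ∈ D.B r a.1 (a.1 + a.2) := by
      intro z hz
      refine D.mem_B.2 ⟨z, ⟨D.mem_of_mem (by lia) hz.1, ?_⟩, 0, zero_mem _, by simp⟩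
      rw [show (a.1 : ℤ) + r - 1 - (r - 1) = a.1 + r - r by ring]
      exact hz.2
    have hw : Submodule.Quotient.mk w = (0 : D.E r a.1 (a.1 + a.2)) ↔
        (w : M) ∈ D.B r a.1 (a.1 + a.2) := Submodule.Quotient.mk_eq_zero _
    constructor
    · rintro ⟨y, hy⟩
      refine ⟨0, zero_mem _, ?_⟩
      rw [map_zero, sub_zero]
      refine hw.1 (hy.symm.trans ?_)
      rw [h0]; rfl
    · rintro ⟨z, hz, hzw⟩
      refine ⟨0, (map_zero _).trans (hw.2 ?_).symm⟩
      simpa using add_mem hzw (hB z hz)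

theorem Z_succ_le (r p n : ℤ) : D.Z (r + 1) p n ≤ D.Z r p n := fun _ hx =>
  ⟨hx.1, D.mem_of_le (by lia) hx.2⟩

/-- The homology of the `r`-th page. -/
def homologyEquiv : D.E (r + 1) a.1 (a.1 + a.2) ≃ₗ[k] (D.page r).homology a := by
  refine ((D.page r).sc a).moduleCatHomologyEquiv
    ((Submodule.mkQ _) ∘ₗ Submodule.inclusion (D.Z_succ_le r a.1 (a.1 + a.2)))
    _ ?_ ?_ ?_
  · intro w
    refine (D.page_sc_g_mk_eq_zero_iff hr a _).2 (D.mem_B.2 ⟨0, zero_mem _, D.d w, ⟨?_, ?_⟩, ?_⟩)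
    · rw [show (a.1 : ℤ) - r - 1 = a.1 - (r + 1) by ring]; exact w.2.2
    · simp [D.d_d]
    · simp
  · intro x hx
    obtain ⟨x, rfl⟩ := Submodule.Quotient.mk_surjective _ x
    obtain ⟨u, hu, v, hv, huv⟩ := D.mem_B.1 ((D.page_sc_g_mk_eq_zero_iff hr a _).1 hx)
    rw [sub_add_cancel, sub_add_cancel] at hu
    -- Since dx = du + v with u of filtration p - 1, the element x - u has the same class and its
    -- differential v lies one step deeper.
    refine ⟨⟨x - u, sub_mem x.2.1 (D.mem_of_le (by lia) hu.1), ?_⟩, 0, ?_⟩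
    · change D.d (x.1 - u) ∈ D.F (a.1 - (r + 1)) (a.1 + a.2 - 1)
      rw [map_sub, ← huv, add_sub_cancel_left, show (a.1 : ℤ) - (r + 1) = a.1 - r - 1 by ring]
      exact hv.1
    · rw [map_zero, add_zero]
      refine (Submodule.Quotient.eq _).2 (D.mem_B.2 ⟨0, zero_mem _, u, hu, ?_⟩)
      change D.d 0 + u = x.1 - (x.1 - u)
      simp
  · intro w
    refine Iff.trans ?_ (D.exists_page_sc_f_eq_mk_iff hr a
      (Submodule.inclusion (D.Z_succ_le r a.1 (a.1 + a.2)) w)).symm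
    refine (D.mem_B (x := (w : M))).trans ?_
    rw [add_sub_cancel_right, show (a.1 : ℤ) + (r + 1) - 1 = a.1 + r by ring]
    constructor
    · rintro ⟨y, hy, z, hz, hw⟩
      refine ⟨y, hy, D.mem_B.2 ⟨0, zero_mem _, z, ⟨hz.1, D.mem_of_le (by lia) hz.2⟩, ?_⟩⟩
      change _ = w.1 - _
      rw [← hw]; simp
    · rintro ⟨z, hz, hw⟩
      obtain ⟨u, hu, v, hv, huv⟩ := D.mem_B.1 hw
      change _ = w.1 - _ at huv
      have hd : D.d v = D.d w.1 := by
        have := congrArg D.d huv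
        simpa [D.d_d] using this
      -- Both boundary terms merge: w = dz + (du + v), and dv = dw gives v the deeper condition
      -- demanded on page r + 1.
      refine ⟨z + u, add_mem hz ⟨D.mem_of_le (by lia) hu.1, ?_⟩, v, D.mem_Z.2 ⟨hv.1, ?_⟩, ?_⟩
      · have := hu.2
        rw [show (a.1 : ℤ) + r - 1 - (r - 1) = a.1 + r - r by ring] at this
        exact this
      · rw [hd, show (a.1 : ℤ) - 1 - r = a.1 - (r + 1) by ring]
        exact w.2.2
      · rw [map_add, add_assoc, huv]; abel

/-- The spectral sequence of a filtered module with differential. -/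
def spectralSequence : HomologicalE2 k where
  page r _ := D.page r
  iso r r' a h hr := by
    subst h
    exact (LinearEquiv.toModuleIso (D.homologyEquiv hr a)).symm

/-- Convergence of the spectral sequence to any module which is identified with the cycles modulo
the boundaries. -/
theorem exists_convergence (H : ℕ → ModuleCat.{u} k)
    (ρ : ∀ n : ℕ, (D.F n n ⊓ LinearMap.ker D.d : Submodule k M) →ₗ[k] H n)
    (hρ : ∀ n, Function.Surjective (ρ n))
    (hker : ∀ n z, ρ n z = 0 ↔ ∃ y ∈ D.F (n + 1) (n + 1), D.d y = z) :
    ∃ c : Convergence D.spectralSequence H, ∀ n p,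
      c.F n p = ((D.F p n).submoduleOf _).map (ρ n) := by
  have hle : ∀ (n : ℕ) (p : ℤ), D.F p n ≤ D.F n n := fun n p x hx => D.mem_of_mem le_rfl hx
  refine ⟨⟨fun n p => ((D.F p n).submoduleOf _).map (ρ n), fun n p p' h => ?_, fun n => ?_,
    fun n => ?_, fun p q r hr hp hq => ?_⟩, fun n p => rfl⟩
  · exact Submodule.map_mono fun x hx => D.mem_of_le h hx
  · refine (Submodule.eq_bot_iff _).2 ?_
    rintro _ ⟨x, hx, rfl⟩
    have : x = 0 := Subtype.ext (D.eq_zero_of_mem (by lia : (-1 : ℤ) < 0) hx)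
    simp [this]
  · refine Submodule.eq_top_iff'.2 fun y => ?_
    obtain ⟨x, rfl⟩ := hρ n y
    exact ⟨x, x.2.1, rfl⟩
  -- As r > p, the differential would land in negative filtration, so Z^r consists of honest cycles.
  · have hZ : ∀ x, x ∈ D.Z r p (p + q) ↔ x ∈ D.F p (p + q) ∧ D.d x = 0 := fun x =>
      ⟨fun h => ⟨h.1, D.eq_zero_of_mem (by lia) h.2⟩, fun h => D.mem_Z.2
        ⟨h.1, by rw [h.2]; exact zero_mem _⟩⟩
    have hle' : D.Z r p (p + q) ≤ D.F (p + q : ℕ) (p + q : ℕ) ⊓ LinearMap.ker D.d := by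
      intro x hx
      refine ⟨hle _ p ?_, ((hZ x).1 hx).2⟩
      push_cast
      exact hx.1
    let N : Submodule k (H (p + q)) := ((D.F p (p + q : ℕ)).submoduleOf _).map (ρ (p + q))
    let N' : Submodule k (H (p + q)) := ((D.F (p - 1) (p + q : ℕ)).submoduleOf _).map (ρ (p + q))
    let φ : D.Z r p (p + q) →ₗ[k] N := LinearMap.codRestrict N
      (ρ (p + q) ∘ₗ Submodule.inclusion hle') fun x => ⟨_, by
        change x.1 ∈ D.F p (p + q : ℕ); push_cast; exact x.2.1, rfl⟩
    let ψ : D.Z r p (p + q) →ₗ[k] N ⧸ N'.submoduleOf N := Submodule.mkQ _ ∘ₗ φ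
    have hψ : Function.Surjective ψ := by
      refine (Submodule.mkQ_surjective _).comp ?_
      rintro ⟨_, x, hx, rfl⟩
      have hx' : x.1 ∈ D.F p (p + q : ℕ) := hx
      push_cast at hx'
      exact ⟨⟨x.1, (hZ _).2 ⟨hx', x.2.2⟩⟩, rfl⟩
    have hψk : (D.B r p (p + q)).submoduleOf (D.Z r p (p + q)) = LinearMap.ker ψ := by
      ext x
      have h1 : x ∈ LinearMap.ker ψ ↔ ρ (p + q) (Submodule.inclusion hle' x) ∈ N' :=
        Submodule.Quotient.mk_eq_zero _
      rw [h1]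
      refine (D.mem_B (x := x.1)).trans ?_
      constructor
      · rintro ⟨y, hy, z, hz, hyz⟩
        have hz0 : D.d z = 0 := by
          have := congrArg D.d hyz
          simpa [D.d_d, ((hZ _).1 x.2).2] using this
        have hz1 : z ∈ D.F (p - 1) (p + q : ℕ) := by push_cast; exact hz.1
        refine ⟨⟨z, hle _ _ hz1, hz0⟩, hz1, ?_⟩
        rw [← sub_eq_zero, ← map_sub, hker]
        refine ⟨-y, D.mem_of_mem le_rfl (p := p + r - 1) (neg_mem (by push_cast; exact hy.1)), ?_⟩
        change D.d (-y) = z - x.1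
        rw [← hyz, map_neg]; abel
      · rintro ⟨z, hz, hzx⟩
        have hz' : z.1 ∈ D.F (p - 1) (p + q : ℕ) := hz
        push_cast at hz'
        rw [← sub_eq_zero, ← map_sub, hker] at hzx
        obtain ⟨y, hy, hyx⟩ := hzx
        replace hyx : D.d y = z.1 - x.1 := hyx
        push_cast at hy
        -- Here q + 1 < r enters: y has total degree p + q + 1 ≤ p + r - 1, so every boundary is
        -- reached from the filtration allowed in B^r.
        refine ⟨-y, D.mem_Z.2 ⟨D.mem_of_mem (by lia) (neg_mem hy), ?_⟩, z.1,
          D.mem_Z.2 ⟨hz', ?_⟩, ?_⟩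
        · rw [show (p : ℤ) + r - 1 - (r - 1) = p by ring, map_neg, hyx, neg_sub,
            add_sub_cancel_right]
          exact sub_mem x.2.1 (D.mem_of_le (by lia) hz')
        · rw [show D.d z.1 = 0 from z.2.2]; exact zero_mem _
        · rw [map_neg, hyx]; abel
    exact ((Submodule.quotEquivOfEq _ _ hψk).trans
      (LinearMap.quotKerEquivOfSurjective ψ hψ)).symm

end FilteredDifferential

/-! ### Homology as a quotient, and cycles tensored with a flat module -/

section HomologicalAlgebra

variable {k : Type u} [CommRing k]

/-- A linear map onto the cycles modulo boundaries identifies the homology of a chain complex with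
a quotient. -/
def ChainComplex.homologyEquiv (K : ChainComplex (ModuleCat.{u} k) ℕ) (n : ℕ)
    {W : Type u} [AddCommGroup W] [Module k W] (φ : W →ₗ[k] K.X n) (N : Submodule k W)
    (h0 : ∀ w, (K.d n (n - 1)).hom (φ w) = 0)
    (h1 : ∀ x, (K.d n (n - 1)).hom x = 0 → ∃ w, φ w = x)
    (h2 : ∀ w, w ∈ N ↔ ∃ y : K.X (n + 1), (K.d (n + 1) n).hom y = φ w) :
    (W ⧸ N) ≃ₗ[k] K.homology n := by
  let ψ : W →ₗ[k] K.homology n := K.homologyClass n ∘ₗ φ.codRestrict _ h0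
  have hψ : Function.Surjective ψ := by
    intro c
    obtain ⟨⟨x, hx⟩, rfl⟩ := K.homologyClass_surjective n c
    obtain ⟨w, rfl⟩ := h1 x hx
    exact ⟨w, rfl⟩
  have hN : N = LinearMap.ker ψ := by
    ext w
    rw [h2, LinearMap.mem_ker]
    exact (K.homologyClass_eq_zero_iff n (φ.codRestrict _ h0 w)).symm
  exact (Submodule.quotEquivOfEq _ _ hN).trans (LinearMap.quotKerEquivOfSurjective ψ hψ)

section TensorCycles

variable (Y : ChainComplex (ModuleCat.{u} k) ℕ) (q : ℕ) (N : Type u) [AddCommGroup N] [Module k N]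

/-- The `q`-cycles of a chain complex of modules. -/
abbrev ChainComplex.cyc : Submodule k (Y.X q) := LinearMap.ker (Y.d q (q - 1)).hom

/-- The differential with values in the cycles. -/
def ChainComplex.toCyc : Y.X (q + 1) →ₗ[k] Y.cyc q :=
  (Y.d (q + 1) q).hom.codRestrict _ fun x => by
    have := Y.d_comp_d (q + 1) q (q - 1)
    exact congrArg (fun f => f.hom x) this

theorem ChainComplex.exact_toCyc_homologyClass :
    Function.Exact (Y.toCyc q) (Y.homologyClass q) := by
  intro z
  rw [Y.homologyClass_eq_zero_iff]
  exact ⟨fun ⟨y, hy⟩ => ⟨y, Subtype.ext hy⟩, fun ⟨y, hy⟩ => ⟨y, congrArg Subtype.val hy⟩⟩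

/-- The map `Z_q(Y) ⊗ N → Y_q ⊗ N`. -/
abbrev ChainComplex.cycTensor : (Y.cyc q) ⊗[k] N →ₗ[k] Y.X q ⊗[k] N :=
  (Y.cyc q).subtype.rTensor N

/-- The map `Z_q(Y) ⊗ N → H_q(Y) ⊗ N`. -/
abbrev ChainComplex.classTensor : (Y.cyc q) ⊗[k] N →ₗ[k] Y.homology q ⊗[k] N :=
  (Y.homologyClass q).rTensor N

theorem ChainComplex.cycTensor_injective [Module.Flat k N] :
    Function.Injective (Y.cycTensor q N) :=
  Module.Flat.rTensor_preserves_injective_linearMap _ (Submodule.subtype_injective _)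

theorem ChainComplex.exists_cycTensor_eq [Module.Flat k N] {x : Y.X q ⊗[k] N}
    (hx : (Y.d q (q - 1)).hom.rTensor N x = 0) : ∃ z, Y.cycTensor q N z = x :=
  (Module.Flat.rTensor_exact N
    (LinearMap.exact_subtype_ker_map (Y.d q (q - 1)).hom) x).1 hx

theorem ChainComplex.rTensor_cycTensor (z : (Y.cyc q) ⊗[k] N) :
    (Y.d q (q - 1)).hom.rTensor N (Y.cycTensor q N z) = 0 := by
  rw [← LinearMap.rTensor_comp_apply,
    (LinearMap.exact_subtype_ker_map (Y.d q (q - 1)).hom).linearMap_comp_eq_zero,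
    LinearMap.rTensor_zero, LinearMap.zero_apply]

theorem ChainComplex.classTensor_surjective : Function.Surjective (Y.classTensor q N) :=
  LinearMap.rTensor_surjective N (Y.homologyClass_surjective q)

theorem ChainComplex.classTensor_eq_zero_iff (z : (Y.cyc q) ⊗[k] N) :
    Y.classTensor q N z = 0 ↔ ∃ w, (Y.toCyc q).rTensor N w = z :=
  rTensor_exact N (Y.exact_toCyc_homologyClass q) (Y.homologyClass_surjective q) z

theorem ChainComplex.cycTensor_toCyc (w : Y.X (q + 1) ⊗[k] N) :
    Y.cycTensor q N ((Y.toCyc q).rTensor N w) = (Y.d (q + 1) q).hom.rTensor N w := by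
  rw [← LinearMap.rTensor_comp_apply]; rfl

theorem ChainComplex.exists_of_classTensor_eq_zero {z : (Y.cyc q) ⊗[k] N}
    (hz : Y.classTensor q N z = 0) :
    ∃ w, (Y.d (q + 1) q).hom.rTensor N w = Y.cycTensor q N z := by
  obtain ⟨w, rfl⟩ := (Y.classTensor_eq_zero_iff q N z).1 hz
  exact ⟨w, (Y.cycTensor_toCyc q N w).symm⟩

/-- Flatness of N embeds Z_q ⊗ N in Y_q ⊗ N, so z is already the image of w in Z_q ⊗ N. -/
theorem ChainComplex.classTensor_eq_zero_of_eq [Module.Flat k N] {z : (Y.cyc q) ⊗[k] N}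
    {w : Y.X (q + 1) ⊗[k] N} (hw : (Y.d (q + 1) q).hom.rTensor N w = Y.cycTensor q N z) :
    Y.classTensor q N z = 0 :=
  (Y.classTensor_eq_zero_iff q N z).2
    ⟨w, Y.cycTensor_injective q N ((Y.cycTensor_toCyc q N w).trans hw)⟩

variable {N} in
theorem LinearMap.lTensor_rTensor_comm {M M' N' : Type u} [AddCommGroup M] [Module k M]
    [AddCommGroup M'] [Module k M'] [AddCommGroup N'] [Module k N'] (f : M →ₗ[k] M')
    (g : N →ₗ[k] N') (x : M ⊗[k] N) :
    g.lTensor M' (f.rTensor N x) = f.rTensor N' (g.lTensor M x) := by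
  rw [← LinearMap.comp_apply, ← LinearMap.comp_apply, LinearMap.lTensor_comp_rTensor,
    LinearMap.rTensor_comp_lTensor]

end TensorCycles

/-! ### The tensor product of two chain complexes as a filtered module with differential -/

section TotalTensor

variable (Y P : ChainComplex (ModuleCat.{u} k) ℕ)

/-- The product of all `Y_q ⊗ P_p`. -/
abbrev TotalTensor : Type u := ∀ p q : ℕ, (Y.X q) ⊗[k] (P.X p)

namespace TotalTensor

/-- The differential of the total complex. -/
def d : TotalTensor Y P →ₗ[k] TotalTensor Y P where
  toFun x p q := (-1 : k) ^ q • (P.d (p + 1) p).hom.lTensor (Y.X q) (x (p + 1) q) +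
    (Y.d (q + 1) q).hom.rTensor (P.X p) (x p (q + 1))
  map_add' x y := by
    funext p q
    simp only [Pi.add_apply, map_add, smul_add]
    abel
  map_smul' c x := by
    funext p q
    simp only [Pi.smul_apply, map_smul, smul_add, RingHom.id_apply, smul_comm c]

variable {Y P}

theorem d_apply (x : TotalTensor Y P) (p q : ℕ) : d Y P x p q =
    (-1 : k) ^ q • (P.d (p + 1) p).hom.lTensor (Y.X q) (x (p + 1) q) +
      (Y.d (q + 1) q).hom.rTensor (P.X p) (x p (q + 1)) := rfl

theorem lTensor_d_d {X : Type u} [AddCommGroup X] [Module k X] (i j l : ℕ) (x : X ⊗[k] P.X i) :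
    (P.d j l).hom.lTensor X ((P.d i j).hom.lTensor X x) = 0 := by
  rw [← LinearMap.lTensor_comp_apply, ← ModuleCat.hom_comp, P.d_comp_d, ModuleCat.hom_zero,
    LinearMap.lTensor_zero, LinearMap.zero_apply]

theorem rTensor_d_d {X : Type u} [AddCommGroup X] [Module k X] (i j l : ℕ) (x : Y.X i ⊗[k] X) :
    (Y.d j l).hom.rTensor X ((Y.d i j).hom.rTensor X x) = 0 := by
  rw [← LinearMap.rTensor_comp_apply, ← ModuleCat.hom_comp, Y.d_comp_d, ModuleCat.hom_zero,
    LinearMap.rTensor_zero, LinearMap.zero_apply]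

/-- The two mixed terms pass through neighbouring degrees q and q + 1, so the sign (-1)^q makes them
cancel. -/
theorem d_d (x : TotalTensor Y P) : d Y P (d Y P x) = 0 := by
  funext p q
  rw [d_apply, d_apply, d_apply]
  simp only [map_add, map_smul, lTensor_d_d, rTensor_d_d, smul_zero, zero_add, add_zero,
    LinearMap.lTensor_rTensor_comm, pow_succ, mul_neg, mul_one, neg_smul, map_neg,
    add_neg_cancel]
  rfl

variable (Y P) in
/-- Elements of total degree `n` and filtration degree at most `p`. -/
def fil (p n : ℤ) : Submodule k (TotalTensor Y P) where
  carrier := {x | ∀ a b : ℕ, ¬((a + b : ℤ) = n ∧ (a : ℤ) ≤ p) → x a b = 0}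
  add_mem' hx hy a b h := by rw [Pi.add_apply, Pi.add_apply, hx a b h, hy a b h, add_zero]
  zero_mem' _ _ _ := rfl
  smul_mem' c x hx a b h := by rw [Pi.smul_apply, Pi.smul_apply, hx a b h, smul_zero]

variable (Y P) in
/-- The total complex filtered by the degree in `P`. -/
def filtered : FilteredDifferential k (TotalTensor Y P) where
  d := d Y P
  F := fil Y P
  d_d := d_d
  mono n p p' h x hx a b hab := hx a b (by lia)
  d_mem hx a b hab := by
    rw [d_apply, hx (a + 1) b (by push_cast; lia), hx a (b + 1) (by push_cast; lia)]
    simp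
  bot {p n} hp := (Submodule.eq_bot_iff _).2 fun x hx => funext fun a => funext fun b =>
    hx a b (by lia)
  top h x hx a b hab := hx a b (by lia)

variable (Y P) in
/-- The element with a single component. -/
def single (p q : ℕ) : Y.X q ⊗[k] P.X p →ₗ[k] TotalTensor Y P :=
  LinearMap.single k (fun p : ℕ => ∀ q : ℕ, (Y.X q) ⊗[k] (P.X p)) p ∘ₗ
    LinearMap.single k (fun q : ℕ => (Y.X q) ⊗[k] (P.X p)) q

@[simp]
theorem single_same (p q : ℕ) (w : Y.X q ⊗[k] P.X p) : single Y P p q w p q = w := by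
  simp [single]

theorem single_of_ne {p q a b : ℕ} (h : ¬(a = p ∧ b = q)) (w : Y.X q ⊗[k] P.X p) :
    single Y P p q w a b = 0 := by
  by_cases ha : a = p
  · subst ha
    have hb : b ≠ q := fun hb => h ⟨rfl, hb⟩
    simp [single, hb]
  · simp [single, ha]

theorem single_mem_fil {p q : ℕ} {p' n : ℤ} {w : Y.X q ⊗[k] P.X p}
    (h : w ≠ 0 → (p + q : ℤ) = n ∧ (p : ℤ) ≤ p') : single Y P p q w ∈ fil Y P p' n := by
  intro a b hab
  by_cases hw : w = 0
  · rw [hw, map_zero]; rfl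
  · refine single_of_ne (fun hc => hab ?_) w
    obtain ⟨rfl, rfl⟩ := hc
    exact h hw

theorem lTensor_d_zero {X : Type u} [AddCommGroup X] [Module k X] (x : X ⊗[k] P.X 0) :
    (P.d 0 (0 - 1)).hom.lTensor X x = 0 := by
  rw [P.shape _ _ (by simp), ModuleCat.hom_zero, LinearMap.lTensor_zero, LinearMap.zero_apply]

theorem rTensor_d_zero {X : Type u} [AddCommGroup X] [Module k X] (x : Y.X 0 ⊗[k] X) :
    (Y.d 0 (0 - 1)).hom.rTensor X x = 0 := by
  rw [Y.shape _ _ (by simp), ModuleCat.hom_zero, LinearMap.rTensor_zero, LinearMap.zero_apply]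

theorem d_single (p q : ℕ) (w : Y.X q ⊗[k] P.X p) : d Y P (single Y P p q w) =
    single Y P (p - 1) q ((-1 : k) ^ q • (P.d p (p - 1)).hom.lTensor (Y.X q) w) +
      single Y P p (q - 1) ((Y.d q (q - 1)).hom.rTensor (P.X p) w) := by
  funext a b
  rw [d_apply, Pi.add_apply, Pi.add_apply]
  congr 1
  · rcases p with _ | p
    · rw [lTensor_d_zero, smul_zero, map_zero, single_of_ne (by lia), map_zero, smul_zero]
      rfl
    · by_cases h : a = p ∧ b = q
      · obtain ⟨rfl, rfl⟩ := h
        rw [single_same]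
        exact (single_same (Y := Y) (P := P) a b _).symm
      · rw [single_of_ne (by lia), single_of_ne (by lia), map_zero, smul_zero]
  · rcases q with _ | q
    · rw [rTensor_d_zero, map_zero, single_of_ne (by lia), map_zero]
      rfl
    · by_cases h : a = p ∧ b = q
      · obtain ⟨rfl, rfl⟩ := h
        rw [single_same]
        exact (single_same (Y := Y) (P := P) a b _).symm
      · rw [single_of_ne (by lia), single_of_ne (by lia), map_zero]

/-- The total complex is acyclic if the complexes `Y_q ⊗ P` are acyclic. -/
theorem exists_d_eq
    (hex : ∀ (p q : ℕ) (z : Y.X q ⊗[k] P.X p), (P.d p (p - 1)).hom.lTensor (Y.X q) z = 0 →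
      ∃ w, (P.d (p + 1) p).hom.lTensor (Y.X q) w = z)
    {n : ℕ} {x : TotalTensor Y P} (hx : x ∈ fil Y P n n) (hdx : d Y P x = 0) :
    ∃ y ∈ fil Y P (n + 1) (n + 1), d Y P y = x := by
  -- Induction on a bound m for the Y-degrees that occur in x, removing the component of highest
  -- Y-degree each time.
  have main : ∀ (m : ℕ) (x : TotalTensor Y P), x ∈ fil Y P n n →
      (∀ a b, m ≤ b → x a b = 0) → d Y P x = 0 →
      ∃ y ∈ fil Y P (n + 1) (n + 1), d Y P y = x := by
    intro m
    induction m with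
    | zero =>
      intro x _ h _
      exact ⟨0, zero_mem _, by rw [map_zero]; funext a b; exact (h a b (Nat.zero_le _)).symm⟩
    | succ m ih =>
      intro x hx h hdx
      by_cases hm : n < m
      · refine ih x hx (fun a b hb => hx a b ?_) hdx
        lia
      · obtain ⟨a, rfl⟩ : ∃ a, n = a + m := ⟨n - m, by lia⟩
        have hz : (P.d a (a - 1)).hom.lTensor (Y.X m) (x a m) = 0 := by
          rcases a with _ | a
          · exact lTensor_d_zero _
          · have := congrFun (congrFun hdx a) m
            rw [d_apply, h a (m + 1) le_rfl, map_zero, add_zero] at this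
            have h2 := congrArg (fun t => (-1 : k) ^ m • t) this
            simp only [smul_smul, ← mul_pow, neg_mul, one_mul, neg_neg, one_pow, one_smul] at h2
            exact h2.trans (smul_zero _)
        -- No component of higher Y-degree interferes, so the top component is a cycle for the
        -- differential of P and hence a boundary. Subtracting the total differential of ±w clears
        -- it and only changes Y-degree m - 1.
        obtain ⟨w, hw⟩ := hex a m _ hz
        have hs : single Y P (a + 1) m ((-1 : k) ^ m • w) ∈
            fil Y P ((a + m : ℕ) + 1) ((a + m : ℕ) + 1) :=
          single_mem_fil fun _ => by push_cast; lia
        have hds : d Y P (single Y P (a + 1) m ((-1 : k) ^ m • w)) =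
            single Y P a m (x a m) + single Y P (a + 1) (m - 1)
              ((Y.d m (m - 1)).hom.rTensor (P.X (a + 1)) ((-1 : k) ^ m • w)) := by
          have e : (-1 : k) ^ m • (P.d (a + 1) a).hom.lTensor (Y.X m) ((-1 : k) ^ m • w) =
              x a m := by
            rw [map_smul, smul_smul, ← mul_pow, hw]
            simp
          rw [d_single]
          exact congrArg₂ (· + ·) (congrArg (single Y P a m) e) rfl
        have hmem : x - d Y P (single Y P (a + 1) m ((-1 : k) ^ m • w)) ∈
            fil Y P (a + m : ℕ) (a + m : ℕ) := by
          refine sub_mem hx ?_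
          have := (filtered Y P).d_mem hs
          rw [add_sub_cancel_right] at this
          exact (filtered Y P).mem_of_mem le_rfl this
        obtain ⟨y, hy, hyx⟩ := ih _ hmem (fun a' b' hb => by
          rw [hds, Pi.sub_apply, Pi.sub_apply, Pi.add_apply, Pi.add_apply]
          by_cases hab : a' = a ∧ b' = m
          · obtain ⟨rfl, rfl⟩ := hab
            rw [single_same, single_of_ne (by lia), add_zero, sub_self]
          · rw [single_of_ne hab, zero_add]
            by_cases hc : a' = a + 1 ∧ b' = m - 1
            · have hb0 : m = 0 := by lia
              subst hb0
              rw [rTensor_d_zero, map_zero]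
              exact (sub_zero _).trans (hx _ _ (by lia))
            · rw [single_of_ne hc, sub_zero]
              rcases hb.eq_or_lt with rfl | hb
              · exact hx _ _ (by lia)
              · exact h _ _ hb) (by rw [map_sub, hdx, d_d, sub_zero])
        exact ⟨y + single Y P (a + 1) m ((-1 : k) ^ m • w), add_mem hy hs, by
          rw [map_add, hyx, sub_add_cancel]⟩
  exact main (n + 1) x hx (fun a b hb => hx a b (by lia)) hdx

theorem neg_one_pow_smul_smul {X : Type u} [AddCommGroup X] [Module k X] (n : ℕ) (x : X) :
    (-1 : k) ^ n • (-1 : k) ^ n • x = x := by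
  rw [smul_smul, ← mul_pow]; simp

variable (Y P)

/-- The complex `H ⊗ P`. -/
abbrev tensorLeftComplex (H : ModuleCat.{u} k) : ChainComplex (ModuleCat.{u} k) ℕ :=
  (((tensoringLeft (ModuleCat.{u} k)).obj H).mapHomologicalComplex _).obj P

set_option maxHeartbeats 1000000 in
/-- The term `E²_{p,q}` is the `p`-th homology of `H_q(Y) ⊗ P`. -/
theorem nonempty_E_two_equiv [∀ p, Module.Flat k (P.X p)] (p q : ℕ) :
    Nonempty ((filtered Y P).E 2 p (p + q) ≃ₗ[k]
      (tensorLeftComplex P (Y.homology q)).homology p) := by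
  set D := filtered Y P with hD
  have hinj := fun p => Y.cycTensor_injective q (P.X p)
  -- The component of dx at (p - 1, q) vanishes because dx has filtration p - 2; it says that the
  -- P-differential of the leading term is a boundary of Y ⊗ P_{p-1}.
  have hdz : ∀ x ∈ D.Z 2 p (p + q), ∃ w, (Y.d (q + 1) q).hom.rTensor (P.X (p - 1)) w =
      (P.d p (p - 1)).hom.lTensor (Y.X q) (x p q) := by
    intro x hx
    rcases p with _ | p
    · exact ⟨0, by rw [lTensor_d_zero, map_zero]⟩
    · have h : d Y P x p q = 0 := hx.2 p q (by push_cast; lia)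
      rw [d_apply] at h
      refine ⟨-((-1 : k) ^ q • x p (q + 1)), ?_⟩
      have h' := congrArg (fun t => (-1 : k) ^ q • t) h
      simp only [smul_add, neg_one_pow_smul_smul, smul_zero] at h'
      rw [map_neg, map_smul]
      exact (eq_neg_of_add_eq_zero_left h').symm
  -- Column p + 1 of x is zero, so the component of dx at (p, q - 1) is just the Y-differential of
  -- the leading term.
  have hv : ∀ x ∈ D.Z 2 p (p + q), (Y.d q (q - 1)).hom.rTensor (P.X p) (x p q) = 0 := by
    intro x hx
    rcases q with _ | q
    · exact rTensor_d_zero _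
    · have h : d Y P x p q = 0 := hx.2 p q (by push_cast; lia)
      rwa [d_apply, hx.1 (p + 1) q (by push_cast; lia), map_zero, smul_zero, zero_add] at h
  let ev : D.Z 2 p (p + q) →ₗ[k] Y.X q ⊗[k] P.X p :=
    (LinearMap.proj q ∘ₗ LinearMap.proj p) ∘ₗ (D.Z 2 p (p + q)).subtype
  -- The leading term is a Y-cycle and P_p is flat, so it lifts uniquely to Z_q ⊗ P_p; its class in
  -- H_q(Y) ⊗ P_p is the required map.
  let σ : D.Z 2 p (p + q) →ₗ[k] Y.cyc q ⊗[k] P.X p :=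
    (LinearEquiv.ofInjective _ (hinj p)).symm.toLinearMap ∘ₗ
      ev.codRestrict (LinearMap.range (Y.cycTensor q (P.X p)))
        (fun x => Y.exists_cycTensor_eq q _ (hv x.1 x.2))
  have hσ : ∀ x, Y.cycTensor q (P.X p) (σ x) = x.1 p q := fun x =>
    LinearEquiv.ofInjective_symm_apply (f := Y.cycTensor q (P.X p)) (h := hinj p) _
  refine ⟨ChainComplex.homologyEquiv (tensorLeftComplex P (Y.homology q)) p
    (Y.classTensor q (P.X p) ∘ₗ σ) _ ?_ ?_ ?_⟩
  · intro x
    obtain ⟨w, hw⟩ := hdz x.1 x.2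
    refine (LinearMap.lTensor_rTensor_comm (Y.homologyClass q) (P.d p (p - 1)).hom (σ x)).trans
      (Y.classTensor_eq_zero_of_eq q _ (w := w) ?_)
    rw [hw, ← hσ, LinearMap.lTensor_rTensor_comm]
  · intro y hy
    obtain ⟨z, rfl⟩ := Y.classTensor_surjective q (P.X p) y
    have hy' : Y.classTensor q _ ((P.d p (p - 1)).hom.lTensor (Y.cyc q) z) = 0 :=
      (LinearMap.lTensor_rTensor_comm (Y.homologyClass q) (P.d p (p - 1)).hom z).symm.trans hy
    obtain ⟨w, hw⟩ := Y.exists_of_classTensor_eq_zero q _ hy'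
    rw [ChainComplex.cycTensor, ← LinearMap.lTensor_rTensor_comm] at hw
    suffices h : ∃ x : D.Z 2 p (p + q), x.1 p q = Y.cycTensor q _ z by
      obtain ⟨x, hx⟩ := h
      exact ⟨x, congrArg (Y.classTensor q _) (hinj p ((hσ x).trans hx))⟩
    rcases p with _ | p
    · refine ⟨⟨single Y P 0 q (Y.cycTensor q _ z), D.mem_Z.2
        ⟨single_mem_fil fun _ => by simp, ?_⟩⟩, single_same _ _ _⟩
      have h : d Y P (single Y P 0 q (Y.cycTensor q _ z)) = 0 := by
        rw [d_single, lTensor_d_zero, Y.rTensor_cycTensor]; simp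
      exact h ▸ zero_mem (fil Y P _ _)
    -- The second component is chosen so that its Y-differential cancels the P-differential of the
    -- first; what is left of the total differential lies two columns below.
    · refine ⟨⟨single Y P (p + 1) q (Y.cycTensor q _ z) +
        single Y P p (q + 1) (-((-1 : k) ^ q • w)), D.mem_Z.2 ⟨add_mem
          (single_mem_fil fun _ => by simp) (single_mem_fil fun _ => by push_cast; lia), ?_⟩⟩, ?_⟩
      · have h : d Y P (single Y P (p + 1) q (Y.cycTensor q _ z) +
            single Y P p (q + 1) (-((-1 : k) ^ q • w))) = single Y P (p - 1) (q + 1)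
              ((-1 : k) ^ (q + 1) • (P.d p (p - 1)).hom.lTensor (Y.X (q + 1))
                (-((-1 : k) ^ q • w))) := by
          rw [map_add, d_single, d_single, Y.rTensor_cycTensor, map_zero, add_zero]
          have e : (Y.d (q + 1) q).hom.rTensor (P.X p) (-((-1 : k) ^ q • w)) =
              -((-1 : k) ^ q • (P.d (p + 1) p).hom.lTensor (Y.X q) (Y.cycTensor q _ z)) := by
            rw [map_neg, map_smul]
            exact congrArg (fun t => -((-1 : k) ^ q • t)) hw
          have e' : single Y P p q ((-1 : k) ^ q • (P.d (p + 1) p).hom.lTensor (Y.X q)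
              (Y.cycTensor q _ z)) + single Y P p q ((Y.d (q + 1) q).hom.rTensor (P.X p)
                (-((-1 : k) ^ q • w))) = 0 := by
            rw [e, ← map_add, add_neg_cancel, map_zero]
          rw [add_left_comm]
          exact (congrArg _ e').trans (add_zero _)
        refine (congrArg (· ∈ fil Y P _ _) h).mpr (single_mem_fil fun h0 => ?_)
        rcases p with _ | p
        · exact absurd (by rw [lTensor_d_zero, smul_zero]) h0
        · push_cast; lia
      · change single Y P (p + 1) q _ (p + 1) q + single Y P p (q + 1) _ (p + 1) q = _
        rw [single_same, single_of_ne (by lia), add_zero]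
  · intro x
    refine (D.mem_B (x := x.1)).trans ?_
    rw [show (p : ℤ) + 2 - 1 = p + 1 by ring, show (2 : ℤ) - 1 = 1 by rfl]
    constructor
    · rintro ⟨u, hu, t, ht, hx⟩
      have hut : x.1 p q = (-1 : k) ^ q • (P.d (p + 1) p).hom.lTensor (Y.X q) (u (p + 1) q) +
          (Y.d (q + 1) q).hom.rTensor (P.X p) (u p (q + 1)) := by
        rw [← d_apply, ← hx]
        change d Y P u p q + t p q = _
        rw [ht.1 p q (by lia), add_zero]
      have hvu : (Y.d q (q - 1)).hom.rTensor (P.X (p + 1)) (u (p + 1) q) = 0 := by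
        rcases q with _ | q
        · exact rTensor_d_zero _
        · have h : d Y P u (p + 1) q = 0 := hu.2 (p + 1) q (by push_cast; lia)
          rwa [d_apply, hu.1 (p + 1 + 1) q (by push_cast; lia), map_zero, smul_zero,
            zero_add] at h
      obtain ⟨z, hz⟩ := Y.exists_cycTensor_eq q _ hvu
      refine ⟨(-1 : k) ^ q • Y.classTensor q _ z, ?_⟩
      change (P.d (p + 1) p).hom.lTensor (Y.homology q) ((-1 : k) ^ q • Y.classTensor q _ z) =
        Y.classTensor q _ (σ x)
      rw [map_smul, ChainComplex.classTensor, LinearMap.lTensor_rTensor_comm, ← map_smul, eq_comm,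
        ← sub_eq_zero, ← map_sub]
      refine Y.classTensor_eq_zero_of_eq q _ (w := u p (q + 1)) ?_
      rw [map_sub, hσ, hut, map_smul, ChainComplex.cycTensor, ← LinearMap.lTensor_rTensor_comm]
      rw [← hz, add_sub_cancel_left]
    · rintro ⟨y, hy⟩
      obtain ⟨z, rfl⟩ := Y.classTensor_surjective q (P.X (p + 1)) y
      replace hy : (P.d (p + 1) p).hom.lTensor (Y.homology q) (Y.classTensor q (P.X (p + 1)) z) =
        Y.classTensor q (P.X p) (σ x) := hy
      rw [LinearMap.lTensor_rTensor_comm, eq_comm, ← sub_eq_zero, ← map_sub] at hy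
      obtain ⟨w, hw⟩ := Y.exists_of_classTensor_eq_zero q _ hy
      rw [map_sub, hσ, ChainComplex.cycTensor, ← LinearMap.lTensor_rTensor_comm] at hw
      -- The sign offsets the one in the total differential, and w accounts for the gap between
      -- equality in H_q(Y) ⊗ P_p and equality of cycles; so du has the same component as x at (p,
      -- q), and x - du drops to filtration p - 1.
      set u : TotalTensor Y P := single Y P (p + 1) q ((-1 : k) ^ q • Y.cycTensor q _ z) +
        single Y P p (q + 1) w with hu
      have hdu : d Y P u = single Y P p q (x.1 p q) + single Y P (p - 1) (q + 1)
          ((-1 : k) ^ (q + 1) • (P.d p (p - 1)).hom.lTensor (Y.X (q + 1)) w) := by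
        rw [hu, map_add, d_single, d_single, map_smul ((Y.d q (q - 1)).hom.rTensor _),
          Y.rTensor_cycTensor, smul_zero, map_zero, add_zero, add_left_comm, add_comm]
        refine congrArg₂ (· + ·) ((map_add (single Y P p q) _ _).symm.trans (congrArg _ ?_)) rfl
        have e : (-1 : k) ^ q • (P.d (p + 1) p).hom.lTensor (Y.X q)
            ((-1 : k) ^ q • Y.cycTensor q (P.X (p + 1)) z) =
            (P.d (p + 1) p).hom.lTensor (Y.X q) (Y.cycTensor q (P.X (p + 1)) z) := by
          rw [map_smul, neg_one_pow_smul_smul]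
        exact (congrArg₂ (· + ·) e hw).trans (add_sub_cancel _ _)
      have hxu : x.1 - d Y P u ∈ fil Y P (p - 1) (p + q) := by
        intro a b hab
        rw [hdu, Pi.sub_apply, Pi.sub_apply, Pi.add_apply, Pi.add_apply]
        by_cases h : a = p ∧ b = q
        · obtain ⟨rfl, rfl⟩ := h
          rw [single_same, single_of_ne (by lia), add_zero, sub_self]
        · rw [single_of_ne h, zero_add, x.2.1 a b (by lia), zero_sub, neg_eq_zero]
          rcases p with _ | p
          · rw [lTensor_d_zero, smul_zero, map_zero]; rfl
          · refine single_of_ne ?_ _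
            push_cast at hab
            lia
      have hun : u ∈ fil Y P (p + 1) (p + q + 1) := add_mem
        (single_mem_fil fun _ => by push_cast; lia) (single_mem_fil fun _ => by push_cast; lia)
      refine ⟨u, D.mem_Z.2 ⟨hun, ?_⟩, x.1 - d Y P u, D.mem_Z.2 ⟨hxu, ?_⟩,
        add_sub_cancel _ _⟩
      · rw [add_sub_cancel_right, add_sub_cancel_right, ← sub_sub_self x.1 (D.d u)]
        exact sub_mem x.2.1 (D.mem_of_le (p := p - 1) (by lia) hxu)
      · have h : D.d (x.1 - d Y P u) = D.d x.1 := by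
          rw [map_sub]
          exact (congrArg _ (d_d u)).trans (sub_zero _)
        rw [h, show (p : ℤ) - 1 - 1 = p - 2 by ring]
        exact x.2.2

end TotalTensor

end TotalTensor

/-! ### Homology classes with coefficients -/

section Coefficients

variable (Y : ChainComplex (ModuleCat.{u} k) ℕ) (N : ModuleCat.{u} k)

/-- The complex `Y ⊗ N`. -/
abbrev ChainComplex.tensorRightComplex : ChainComplex (ModuleCat.{u} k) ℕ :=
  ((tensorRight N).mapHomologicalComplex _).obj Y

/-- The homology class in `Y ⊗ N` of an element of the kernel of the differential. -/
def ChainComplex.tensorHomologyClass (n : ℕ) :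
    LinearMap.ker ((Y.d n (n - 1)).hom.rTensor N) →ₗ[k] (Y.tensorRightComplex N).homology n :=
  (Y.tensorRightComplex N).homologyClass n

theorem ChainComplex.tensorHomologyClass_surjective (n : ℕ) :
    Function.Surjective (Y.tensorHomologyClass N n) :=
  (Y.tensorRightComplex N).homologyClass_surjective n

theorem ChainComplex.tensorHomologyClass_eq_zero_iff (n : ℕ)
    (z : LinearMap.ker ((Y.d n (n - 1)).hom.rTensor N)) :
    Y.tensorHomologyClass N n z = 0 ↔ ∃ y, (Y.d (n + 1) n).hom.rTensor N y = z :=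
  (Y.tensorRightComplex N).homologyClass_eq_zero_iff n z

/-- The map `Z_n(Y) ⊗ N → H_n(Y ⊗ N)`. -/
def ChainComplex.cycTensorClass (n : ℕ) :
    Y.cyc n ⊗[k] N →ₗ[k] (Y.tensorRightComplex N).homology n :=
  Y.tensorHomologyClass N n ∘ₗ
    (Y.cycTensor n N).codRestrict _ (Y.rTensor_cycTensor n N)

end Coefficients

/-! ### Comparison of Y ⊗ P with Y ⊗ N through the augmented total complex -/

namespace TotalTensor

variable (Y P : ChainComplex (ModuleCat.{u} k) ℕ) {N : ModuleCat.{u} k} (ε : P.X 0 ⟶ N)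
  (w : P.d 1 0 ≫ ε = 0)

/-- The element of `Y ⊗ (N ← P)` with the given components. -/
def cons (b : ∀ q, Y.X q ⊗[k] N) (x : TotalTensor Y P) :
    TotalTensor Y (ChainComplex.augment P ε w)
  | 0 => b
  | p + 1 => x p

variable {Y P ε w}

theorem d_cons_zero (b : ∀ q, Y.X q ⊗[k] N) (x : TotalTensor Y P) (q : ℕ) :
    d Y _ (cons Y P ε w b x) 0 q = (-1 : k) ^ q • ε.hom.lTensor (Y.X q) (x 0 q) +
      (Y.d (q + 1) q).hom.rTensor N (b (q + 1)) := rfl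

/-- The components of an element of `Y ⊗ (N ← P)` in `Y ⊗ P`. -/
def tail (x : TotalTensor Y (ChainComplex.augment P ε w)) : TotalTensor Y P := fun p => x (p + 1)

theorem d_succ (x : TotalTensor Y (ChainComplex.augment P ε w)) (p q : ℕ) :
    d Y _ x (p + 1) q = d Y P (tail x) p q := rfl

theorem d_zero (x : TotalTensor Y (ChainComplex.augment P ε w)) (q : ℕ) :
    d Y _ x 0 q = (-1 : k) ^ q • ε.hom.lTensor (Y.X q) (tail x 0 q) +
      (Y.d (q + 1) q).hom.rTensor N (x 0 (q + 1)) := rfl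

theorem lTensor_augmentation_d (hε : P.d 1 0 ≫ ε = 0) {X : Type u} [AddCommGroup X] [Module k X]
    (y : X ⊗[k] P.X (0 + 1)) : ε.hom.lTensor X ((P.d (0 + 1) 0).hom.lTensor X y) = 0 := by
  rw [← LinearMap.lTensor_comp_apply, ← ModuleCat.hom_comp, hε, ModuleCat.hom_zero,
    LinearMap.lTensor_zero, LinearMap.zero_apply]

-- Apply ε to the component of dx = 0 in column 0: the contribution of column 1 is killed because ε
-- annihilates `P.d 1 0`.
include w in
theorem rTensor_augmentation {n : ℕ} {x : TotalTensor Y P} (hx : d Y P x = 0) :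
    (Y.d n (n - 1)).hom.rTensor N (ε.hom.lTensor (Y.X n) (x 0 n)) = 0 := by
  rcases n with _ | n
  · exact rTensor_d_zero _
  · have h := congrArg (ε.hom.lTensor (Y.X n)) (congrFun (congrFun hx 0) n)
    rw [d_apply, map_add, map_smul, lTensor_augmentation_d w, smul_zero, zero_add,
      LinearMap.lTensor_rTensor_comm] at h
    exact h.trans (map_zero _)

section

variable (hex : ∀ (p q : ℕ) (z : Y.X q ⊗[k] (ChainComplex.augment P ε w).X p),
  ((ChainComplex.augment P ε w).d p (p - 1)).hom.lTensor (Y.X q) z = 0 →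
    ∃ y, ((ChainComplex.augment P ε w).d (p + 1) p).hom.lTensor (Y.X q) y = z)

include hex

/-- Surjectivity on homology. Placed in the extra column, b is a cycle of an acyclic complex; the
part of a bounding element outside that column, times (-1)^n, is the cycle x, and the part inside it
supplies b'. -/
theorem exists_cycle_of_augmentation {n : ℕ} {b : Y.X n ⊗[k] N}
    (hb : (Y.d n (n - 1)).hom.rTensor N b = 0) :
    ∃ x ∈ fil Y P n n, d Y P x = 0 ∧
      ∃ b', b = ε.hom.lTensor (Y.X n) (x 0 n) + (Y.d (n + 1) n).hom.rTensor N b' := by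
  let b₀ : Y.X n ⊗[k] (ChainComplex.augment P ε w).X 0 := b
  have h0 : d Y _ (single Y (ChainComplex.augment P ε w) 0 n b₀) = 0 := by
    rw [d_single, lTensor_d_zero, smul_zero, map_zero, zero_add]
    exact (congrArg _ hb).trans (map_zero _)
  obtain ⟨y, hy, hyb⟩ := exists_d_eq hex (n := n)
    (single_mem_fil (p := 0) (q := n) (w := b₀) fun _ => by simp) h0
  refine ⟨(-1 : k) ^ n • tail y, Submodule.smul_mem _ _ fun a b hab => hy _ _ ?_, ?_,
    y 0 (n + 1), ?_⟩
  · push_cast; lia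
  · rw [map_smul]
    have : d Y P (tail y) = 0 := by
      funext p q
      rw [← d_succ (x := y), hyb]
      exact single_of_ne (by lia) _
    rw [this, smul_zero]
  · have h := congrFun (congrFun hyb 0) n
    rw [single_same, d_zero, ← map_smul] at h
    exact h.symm

/-- Injectivity on homology. Adjoining ∓b in the extra column turns x into a cycle of the acyclic
augmented complex; deleting that column from a bounding element leaves one that bounds x. -/
theorem exists_d_eq_of_augmentation {n : ℕ} {x : TotalTensor Y P} (hx : x ∈ fil Y P n n)
    (hdx : d Y P x = 0) {b : Y.X (n + 1) ⊗[k] N}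
    (hb : (Y.d (n + 1) n).hom.rTensor N b = ε.hom.lTensor (Y.X n) (x 0 n)) :
    ∃ y ∈ fil Y P (n + 1) (n + 1), d Y P y = x := by
  set c : ∀ q, Y.X q ⊗[k] N := Pi.single (n + 1) (-((-1 : k) ^ n • b)) with hc
  have hmem : cons Y P ε w c x ∈ fil Y _ (n + 1 : ℕ) (n + 1 : ℕ) := by
    rintro (_ | a) q haq
    · exact Pi.single_eq_of_ne (by rintro rfl; exact haq (by simp; lia)) _
    · exact hx a q (by push_cast at haq; lia)
  have hd : d Y _ (cons Y P ε w c x) = 0 := by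
    funext p q
    rcases p with _ | p
    · rw [d_cons_zero]
      by_cases hq : q = n
      · subst hq
        rw [hc, Pi.single_eq_same, map_neg, map_smul, hb, add_neg_cancel]
        rfl
      · rw [hx 0 q (by lia), hc, Pi.single_eq_of_ne (by lia), map_zero, map_zero, smul_zero,
          add_zero]
        rfl
    · rw [d_succ]
      exact congrFun (congrFun hdx p) q
  obtain ⟨y, hy, hyx⟩ := exists_d_eq hex hmem hd
  refine ⟨tail y, fun a b hab => hy _ _ (by push_cast; lia), ?_⟩
  funext p q
  rw [← d_succ (x := y), hyx]
  rfl

variable [∀ p, Module.Flat k (P.X p)] (hε : Function.Surjective ε.hom)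

include hε

/-- The spectral sequence of the filtered total complex of `Y ⊗ P` converges to the homology of
`Y ⊗ N`, and the filtration starts with the image of `Z_n(Y) ⊗ N`. -/
theorem exists_convergence :
    ∃ c : Convergence (filtered Y P).spectralSequence
      (fun n => (Y.tensorRightComplex N).homology n),
      ∀ n, c.F n 0 = LinearMap.range (Y.cycTensorClass N n) := by
  let e : ∀ n : ℕ, TotalTensor Y P →ₗ[k] Y.X n ⊗[k] N := fun n =>
    ε.hom.lTensor (Y.X n) ∘ₗ LinearMap.proj n ∘ₗ LinearMap.proj 0
  have he : ∀ (n : ℕ) (x : ((filtered Y P).F n n ⊓ LinearMap.ker (filtered Y P).d :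
      Submodule k (TotalTensor Y P))),
      (e n ∘ₗ Submodule.subtype _) x ∈ LinearMap.ker ((Y.d n (n - 1)).hom.rTensor N) :=
    fun n x => rTensor_augmentation (w := w) x.2.2
  obtain ⟨c, hc⟩ := (filtered Y P).exists_convergence
    (fun n => (Y.tensorRightComplex N).homology n)
    (fun n => Y.tensorHomologyClass N n ∘ₗ (e n ∘ₗ Submodule.subtype _).codRestrict _ (he n))
    (fun n y => by
      obtain ⟨⟨b, hb⟩, rfl⟩ := Y.tensorHomologyClass_surjective N n y
      obtain ⟨x, hx, hdx, b', hb'⟩ := exists_cycle_of_augmentation hex hb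
      refine ⟨⟨x, hx, hdx⟩, ?_⟩
      rw [← sub_eq_zero, LinearMap.comp_apply, ← map_sub, Y.tensorHomologyClass_eq_zero_iff]
      refine ⟨-b', ?_⟩
      change _ = ε.hom.lTensor (Y.X n) (x 0 n) - b
      rw [hb', map_neg]; abel)
    (fun n z => by
      rw [LinearMap.comp_apply, Y.tensorHomologyClass_eq_zero_iff]
      constructor
      · rintro ⟨b, hb⟩
        exact exists_d_eq_of_augmentation hex z.2.1 z.2.2 hb
      · rintro ⟨y, hy, hyz⟩
        refine ⟨ε.hom.lTensor (Y.X (n + 1)) (y 0 (n + 1)), ?_⟩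
        change _ = ε.hom.lTensor (Y.X n) (z.1 0 n)
        rw [← hyz]
        change _ = ε.hom.lTensor (Y.X n) (d Y P y 0 n)
        rw [d_apply, map_add, map_smul, lTensor_augmentation_d w, smul_zero, zero_add,
          LinearMap.lTensor_rTensor_comm])
  refine ⟨c, fun n => ?_⟩
  rw [hc]
  ext y
  constructor
  -- A cycle of filtration 0 lives in column 0, so its component is a Y-cycle and comes from Z_n ⊗
  -- P_0 by flatness of P_0.
  · rintro ⟨x, hx, rfl⟩
    have hx0 : x.1 ∈ fil Y P 0 n := hx
    have hv : (Y.d n (n - 1)).hom.rTensor (P.X 0) (x.1 0 n) = 0 := by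
      rcases n with _ | n
      · exact rTensor_d_zero _
      · have h : d Y P x.1 0 n = 0 := congrFun (congrFun x.2.2 0) n
        rwa [d_apply, hx0 (0 + 1) n (by push_cast; lia), map_zero, smul_zero, zero_add] at h
    obtain ⟨z, hz⟩ := Y.exists_cycTensor_eq n _ hv
    refine ⟨ε.hom.lTensor _ z, congrArg (Y.tensorHomologyClass N n) (Subtype.ext ?_)⟩
    change Y.cycTensor n N (ε.hom.lTensor _ z) = ε.hom.lTensor _ (x.1 0 n)
    rw [← hz, LinearMap.lTensor_rTensor_comm]
  -- Conversely Z_n ⊗ P_0 maps onto Z_n ⊗ N, and an element of it placed in column 0 is a total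
  -- cycle.
  · rintro ⟨z, rfl⟩
    obtain ⟨z, rfl⟩ := LinearMap.lTensor_surjective (Y.cyc n) hε z
    have hd : d Y P (single Y P 0 n (Y.cycTensor n _ z)) = 0 := by
      rw [d_single, lTensor_d_zero, Y.rTensor_cycTensor]; simp
    have hm : ∀ m : ℤ, 0 ≤ m → single Y P 0 n (Y.cycTensor n _ z) ∈ fil Y P m n := fun m hm =>
      single_mem_fil fun _ => by simp [hm]
    refine ⟨⟨single Y P 0 n (Y.cycTensor n _ z), hm _ (by lia), hd⟩, hm _ le_rfl,
      congrArg (Y.tensorHomologyClass N n) (Subtype.ext ?_)⟩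
    change ε.hom.lTensor _ (single Y P 0 n (Y.cycTensor n _ z) 0 n) =
      Y.cycTensor n N (ε.hom.lTensor _ z)
    rw [single_same, LinearMap.lTensor_rTensor_comm]

end

end TotalTensor

/-! ### Degeneration of a spectral sequence with two columns -/

namespace HomologicalE2

theorem two_le_two : (2 : ℤ) ≤ 2 := le_rfl

variable (E : HomologicalE2 k)
  (hE : ∀ p q : ℕ, 2 ≤ p → IsZero ((E.page 2 HomologicalE2.two_le_two).X (p, q)))

include hE

theorem isZero_page_X {r : ℤ} (hr : 2 ≤ r) {p : ℕ} (q : ℕ) (hp : 2 ≤ p) :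
    IsZero ((E.page r hr).X (p, q)) := by
  induction r, hr using Int.leInduction with
  | base => exact hE p q hp
  | succ r hr ih =>
    exact (ShortComplex.isZero_homology_of_isZero_X₂ ((E.page r hr).sc (p, q)) ih).of_iso
      (E.iso r (r + 1) (p, q) rfl hr).symm

/-- Differentials into columns 0 and 1 start in columns p + r ≥ 2, which are zero; those out of them
would end at p - r < 0. -/
theorem nonempty_page_X_iso {r : ℤ} (hr : 2 ≤ r) {p : ℕ} (q : ℕ) (hp : p ≤ 1) :
    Nonempty ((E.page r hr).X (p, q) ≅ (E.page 2 HomologicalE2.two_le_two).X (p, q)) := by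
  induction r, hr using Int.leInduction with
  | base => exact ⟨Iso.refl _⟩
  | succ r hr ih =>
    obtain ⟨e⟩ := ih
    have hf : ((E.page r hr).sc (p, q)).f = 0 := by
      change (E.page r hr).d _ _ = 0
      generalize (ComplexShape.spectralSequenceNat ((-r, r - 1) : ℤ × ℤ)).prev (p, q) = b
      by_cases h : (ComplexShape.spectralSequenceNat ((-r, r - 1) : ℤ × ℤ)).Rel b (p, q)
      · have h1 := h.1
        dsimp at h1
        exact (E.isZero_page_X hE hr b.2 (p := b.1) (by lia)).eq_of_src _ _
      · exact (E.page r hr).shape _ _ h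
    have hg : ((E.page r hr).sc (p, q)).g = 0 := by
      refine (E.page r hr).shape _ _ fun h => ?_
      have h1 := h.1
      dsimp at h1
      lia
    exact ⟨(E.iso r (r + 1) (p, q) rfl hr).symm ≪≫
      (ShortComplex.HomologyData.ofZeros _ hf hg).left.homologyIso ≪≫ e⟩

end HomologicalE2

namespace Convergence

variable {E : HomologicalE2 k} {H : ℕ → ModuleCat.{u} k} (c : Convergence E H)

theorem nonempty_gr {n p q : ℕ} (h : p + q = n) {r : ℤ} (hr : 2 ≤ r) (hp : (p : ℤ) < r)
    (hq : (q : ℤ) + 1 < r) :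
    Nonempty ((c.F n p ⧸ (c.F n (p - 1)).submoduleOf (c.F n p)) ≃ₗ[k] (E.page r hr).X (p, q)) := by
  subst h
  exact ⟨c.gr p q r hr hp hq⟩

variable (hE : ∀ p q : ℕ, 2 ≤ p → IsZero ((E.page 2 HomologicalE2.two_le_two).X (p, q)))

include hE

theorem nonempty_gr_E_two {n p q : ℕ} (h : p + q = n) (hp : p ≤ 1) :
    Nonempty ((c.F n p ⧸ (c.F n (p - 1)).submoduleOf (c.F n p)) ≃ₗ[k]
      (E.page 2 HomologicalE2.two_le_two).X (p, q)) := by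
  obtain ⟨e⟩ := c.nonempty_gr h (r := p + q + 2) (by lia) (by lia) (by lia)
  obtain ⟨e'⟩ := E.nonempty_page_X_iso hE (r := p + q + 2) (by lia) q hp
  exact ⟨e.trans e'.toLinearEquiv⟩

/-- The graded pieces with p ≥ 2 vanish, so every step of the filtration up to F_n is already
contained in F_1. -/
theorem F_one_eq_top (n : ℕ) : c.F n 1 = ⊤ := by
  have h : ∀ j : ℕ, 1 + j ≤ n → c.F n (1 + j) ≤ c.F n 1 := by
    intro j
    induction j with
    | zero => intro _; simp
    | succ j ih =>
      intro hj
      obtain ⟨e⟩ := c.nonempty_gr (n := n) (p := 1 + (j + 1)) (q := n - (1 + (j + 1))) (by lia)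
        (r := n + 3) (by lia) (by lia) (by lia)
      have hz := E.isZero_page_X hE (r := n + 3) (by lia) (n - (1 + (j + 1)))
        (p := 1 + (j + 1)) (by lia)
      have hs := ModuleCat.subsingleton_of_isZero hz
      have hs' := e.toEquiv.subsingleton
      rw [Submodule.Quotient.subsingleton_iff, Submodule.submoduleOf_eq_top] at hs'
      push_cast at hs' ⊢
      rw [show (1 : ℤ) + (j + 1) - 1 = 1 + j by ring] at hs'
      exact hs'.trans (ih (by lia))
  refine top_le_iff.1 ?_
  rw [← c.top n]
  rcases n with _ | n
  · exact c.mono 0 (by simp)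
  · have := h n (by lia)
    rw [Nat.cast_succ, add_comm (n : ℤ)]
    exact this

theorem exists_mono_range_eq (n : ℕ) {X : ModuleCat.{u} k}
    (e : X ≅ (E.page 2 HomologicalE2.two_le_two).X (0, n)) :
    ∃ f : X ⟶ H n, Mono f ∧ LinearMap.range f.hom = c.F n 0 := by
  obtain ⟨e'⟩ := c.nonempty_gr_E_two hE (p := 0) (q := n) (n := n) (by lia) (by lia)
  have hb : (c.F n ((0 : ℕ) - 1 : ℤ)).submoduleOf (c.F n (0 : ℕ)) = ⊥ := by
    have : ((0 : ℕ) - 1 : ℤ) = -1 := by simp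
    rw [this, c.bot, Submodule.submoduleOf, Submodule.comap_bot, Submodule.ker_subtype]
  let e'' : X ≃ₗ[k] c.F n 0 :=
    (e.toLinearEquiv.trans e'.symm).trans (Submodule.quotEquivOfEqBot _ hb)
  refine ⟨ModuleCat.ofHom ((c.F n 0).subtype ∘ₗ e''.toLinearMap), ?_, ?_⟩
  · rw [ModuleCat.mono_iff_injective]
    exact (Submodule.subtype_injective _).comp e''.injective
  · rw [ModuleCat.hom_ofHom, LinearMap.range_comp, LinearEquiv.range, Submodule.map_top,
      Submodule.range_subtype]

theorem exists_epi_ker_eq (n : ℕ) {X : ModuleCat.{u} k}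
    (e : X ≅ (E.page 2 HomologicalE2.two_le_two).X (1, n)) :
    ∃ g : H (n + 1) ⟶ X, Epi g ∧ LinearMap.ker g.hom = c.F (n + 1) 0 := by
  obtain ⟨e'⟩ := c.nonempty_gr_E_two hE (p := 1) (q := n) (n := n + 1) (by lia) (by lia)
  have hm : ∀ x : H (n + 1), LinearMap.id (R := k) x ∈ c.F (n + 1) (1 : ℕ) := fun x => by
    rw [Nat.cast_one, c.F_one_eq_top hE]; trivial
  let π : H (n + 1) →ₗ[k] _ := Submodule.mkQ ((c.F (n + 1) ((1 : ℕ) - 1)).submoduleOf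
    (c.F (n + 1) (1 : ℕ))) ∘ₗ LinearMap.codRestrict _ LinearMap.id hm
  let e'' := e'.trans e.symm.toLinearEquiv
  refine ⟨ModuleCat.ofHom (e''.toLinearMap ∘ₗ π), ?_, ?_⟩
  · rw [ModuleCat.epi_iff_surjective]
    exact e''.surjective.comp ((Submodule.mkQ_surjective _).comp fun y => ⟨y.1, rfl⟩)
  · ext x
    rw [ModuleCat.hom_ofHom, LinearMap.mem_ker, LinearMap.comp_apply]
    refine e''.map_eq_zero_iff.trans ((Submodule.Quotient.mk_eq_zero _).trans ?_)
    have : ((1 : ℕ) - 1 : ℤ) = 0 := by simp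
    rw [this]
    rfl

/-- A convergent spectral sequence with two columns gives short exact sequences. -/
theorem exists_shortExact (n : ℕ) {X₀ X₁ : ModuleCat.{u} k}
    (e₀ : X₀ ≅ (E.page 2 HomologicalE2.two_le_two).X (0, n + 1))
    (e₁ : X₁ ≅ (E.page 2 HomologicalE2.two_le_two).X (1, n)) :
    ∃ (f : X₀ ⟶ H (n + 1)) (g : H (n + 1) ⟶ X₁) (w : f ≫ g = 0),
      (ShortComplex.mk f g w).ShortExact ∧ LinearMap.range f.hom = c.F (n + 1) 0 := by
  obtain ⟨f, hf, hfr⟩ := c.exists_mono_range_eq hE (n + 1) e₀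
  obtain ⟨g, hg, hgk⟩ := c.exists_epi_ker_eq hE n e₁
  have h : LinearMap.range f.hom = LinearMap.ker g.hom := hfr.trans hgk.symm
  have w : f ≫ g = 0 := by
    ext x
    exact h.le ⟨x, rfl⟩
  exact ⟨f, g, w, { exact := (ShortComplex.moduleCat_exact_iff_range_eq_ker _).2 h }, hfr⟩

-- In degree 0 the step F_0 is everything, so the injection with image F_0 is onto.
include c in
theorem exists_isIso_zero {X : ModuleCat.{u} k}
    (e : X ≅ (E.page 2 HomologicalE2.two_le_two).X (0, 0)) :
    ∃ f : X ⟶ H 0, IsIso f := by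
  obtain ⟨f, hf, hfr⟩ := c.exists_mono_range_eq hE 0 e
  have : Epi f := by
    rw [ModuleCat.epi_iff_range_eq_top, hfr]
    exact c.top 0
  exact ⟨f, isIso_of_mono_of_epi f⟩

end Convergence

/-! ### Exactness of the augmented resolution after tensoring with a flat module -/

namespace CategoryTheory.ProjectiveResolution

variable {N : ModuleCat.{u} k} (R : ProjectiveResolution N)

/-- The augmentation of a projective resolution. -/
abbrev augmentation : R.complex.X 0 ⟶ N := R.π.f 0

theorem d_augmentation : R.complex.d 1 0 ≫ R.augmentation = 0 := R.complex_d_comp_π_f_zero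

theorem augmentation_surjective : Function.Surjective R.augmentation.hom :=
  (ModuleCat.epi_iff_surjective R.augmentation).1 (inferInstanceAs (Epi (R.π.f 0)))

theorem flat_complex_X (p : ℕ) : Module.Flat k (R.complex.X p) :=
  have : Module.Projective k (R.complex.X p) := (IsProjective.iff_projective _).2 (R.projective p)
  inferInstance

/-- Position 0 is surjectivity of the augmentation, position 1 exactness at P_0, the others
exactness of the resolution; flatness of X keeps them exact. -/
theorem exists_lTensor_augment_d_eq (X : Type u) [AddCommGroup X] [Module k X] [Module.Flat k X]
    (p : ℕ) (z : X ⊗[k] (R.complex.augment R.augmentation R.d_augmentation).X p)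
    (hz : ((R.complex.augment R.augmentation R.d_augmentation).d p (p - 1)).hom.lTensor X z = 0) :
    ∃ y, ((R.complex.augment R.augmentation R.d_augmentation).d (p + 1) p).hom.lTensor X y
      = z := by
  rcases p with _ | _ | p
  · exact LinearMap.lTensor_surjective X R.augmentation_surjective z
  · exact (Module.Flat.lTensor_exact X ((ShortComplex.ShortExact.moduleCat_exact_iff_function_exact
      _).1 R.exact₀) z).1 hz
  · exact (Module.Flat.lTensor_exact X ((ShortComplex.ShortExact.moduleCat_exact_iff_function_exact
      _).1 (R.exact_succ p)) z).1 hz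

end CategoryTheory.ProjectiveResolution

/-! ### Splitting over hereditary rings -/

namespace ChainComplex

variable (Y : ChainComplex (ModuleCat.{u} k) ℕ) (N : ModuleCat.{u} k)

/-- The image of Y_n in Y_{n-1} is projective as a submodule of a projective, so Y_n → image has a
section s; y ↦ y - s(dy) projects Y_n onto the cycles. -/
theorem exists_extend_homologyClass (hk : IsHereditaryRing k)
    (hY : ∀ n, Module.Projective k (Y.X n)) (n : ℕ) :
    ∃ r : Y.X n →ₗ[k] Y.homology n, r ∘ₗ (Y.cyc n).subtype = Y.homologyClass n := by
  have := hk (Y.X (n - 1)) (hY _) (LinearMap.range (Y.d n (n - 1)).hom)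
  obtain ⟨s, hs⟩ := Module.projective_lifting_property (Y.d n (n - 1)).hom.rangeRestrict
    LinearMap.id (LinearMap.surjective_rangeRestrict _)
  let t : Y.X n →ₗ[k] Y.X n := LinearMap.id - s ∘ₗ (Y.d n (n - 1)).hom.rangeRestrict
  have ht : ∀ y, t y ∈ Y.cyc n := fun y => by
    have := congrArg Subtype.val (LinearMap.congr_fun hs ((Y.d n (n - 1)).hom.rangeRestrict y))
    change (Y.d n (n - 1)).hom (y - s ((Y.d n (n - 1)).hom.rangeRestrict y)) = 0
    rw [map_sub, sub_eq_zero]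
    exact this.symm
  refine ⟨Y.homologyClass n ∘ₗ t.codRestrict _ ht, LinearMap.ext fun z => ?_⟩
  refine congrArg (Y.homologyClass n) (Subtype.ext ?_)
  have : (Y.d n (n - 1)).hom.rangeRestrict z.1 = 0 := Subtype.ext z.2
  change z.1 - s ((Y.d n (n - 1)).hom.rangeRestrict z.1) = z.1
  rw [this, map_zero, sub_zero]

/-- If the map from cycles to homology extends to `Y_n`, then the map `H_n(Y) ⊗ N → H_n(Y ⊗ N)`
has a retraction. -/
theorem exists_retraction (n : ℕ) {r : Y.X n →ₗ[k] Y.homology n}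
    (hr : r ∘ₗ (Y.cyc n).subtype = Y.homologyClass n) :
    ∃ R : (Y.tensorRightComplex N).homology n →ₗ[k] Y.homology n ⊗[k] N,
      ∀ z, R (Y.cycTensorClass N n z) = Y.classTensor n N z := by
  have hrd : r ∘ₗ (Y.d (n + 1) n).hom = 0 := by
    have h : (Y.d (n + 1) n).hom = (Y.cyc n).subtype ∘ₗ Y.toCyc n := rfl
    rw [h, ← LinearMap.comp_assoc, hr, (Y.exact_toCyc_homologyClass n).linearMap_comp_eq_zero]
  let cls := Y.tensorHomologyClass N n
  let φ : LinearMap.ker ((Y.d n (n - 1)).hom.rTensor N) →ₗ[k] Y.homology n ⊗[k] N :=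
    r.rTensor N ∘ₗ Submodule.subtype _
  have hφ : LinearMap.ker cls ≤ LinearMap.ker φ := by
    intro z hz
    obtain ⟨y, hy⟩ := (Y.tensorHomologyClass_eq_zero_iff N n z).1 hz
    change r.rTensor N z.1 = 0
    rw [← hy, ← LinearMap.rTensor_comp_apply, hrd, LinearMap.rTensor_zero, LinearMap.zero_apply]
  refine ⟨(LinearMap.ker cls).liftQ φ hφ ∘ₗ
    (cls.quotKerEquivOfSurjective (Y.tensorHomologyClass_surjective N n)).symm.toLinearMap,
    fun z => ?_⟩
  have h : (cls.quotKerEquivOfSurjective (Y.tensorHomologyClass_surjective N n)).symm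
      (Y.cycTensorClass N n z) = Submodule.Quotient.mk
        ((Y.cycTensor n N).codRestrict _ (Y.rTensor_cycTensor n N) z) := by
    rw [LinearEquiv.symm_apply_eq]; rfl
  rw [LinearMap.comp_apply, LinearEquiv.coe_coe, h, Submodule.liftQ_apply]
  change r.rTensor N (Y.cycTensor n N z) = _
  rw [← LinearMap.rTensor_comp_apply, hr]

/-- Only the image of `S.f` is known. If R kills an element of it, written as the class of z in Z_n
⊗ N, then z is a boundary and the class is zero; and R maps the image onto H_n(Y) ⊗ N. So R composed
with `S.f` is bijective, and correcting R by its inverse gives the retraction. -/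
theorem nonempty_splitting {n : ℕ} {r : Y.X n →ₗ[k] Y.homology n}
    (hr : r ∘ₗ (Y.cyc n).subtype = Y.homologyClass n) {S : ShortComplex (ModuleCat.{u} k)}
    (hS : S.ShortExact) (e : S.X₂ ≅ (Y.tensorRightComplex N).homology n)
    (hf : LinearMap.range (S.f ≫ e.hom).hom = LinearMap.range (Y.cycTensorClass N n)) :
    Nonempty S.Splitting := by
  obtain ⟨R, hR⟩ := Y.exists_retraction N n hr
  have := hS.mono_f
  have hfinj : Function.Injective (S.f ≫ e.hom).hom :=
    (ModuleCat.mono_iff_injective _).1 inferInstance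
  have hbij : Function.Bijective (R ∘ₗ (S.f ≫ e.hom).hom) := by
    constructor
    · refine (injective_iff_map_eq_zero _).2 fun x hx => ?_
      obtain ⟨z, hz⟩ := hf.le ⟨x, rfl⟩
      rw [LinearMap.comp_apply, ← hz, hR] at hx
      obtain ⟨w, rfl⟩ := (Y.classTensor_eq_zero_iff n N z).1 hx
      refine hfinj ?_
      rw [map_zero, ← hz]
      refine (Y.tensorHomologyClass_eq_zero_iff N n _).2 ⟨w, ?_⟩
      exact (Y.cycTensor_toCyc n N w).symm
    · intro y
      obtain ⟨z, rfl⟩ := Y.classTensor_surjective n N y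
      obtain ⟨x, hx⟩ := hf.ge ⟨z, rfl⟩
      exact ⟨x, by rw [LinearMap.comp_apply, hx, hR]⟩
  let s := LinearEquiv.ofBijective _ hbij
  have := hS.epi_g
  refine ⟨ShortComplex.Splitting.ofExactOfRetraction S hS.exact
    (e.hom ≫ ModuleCat.ofHom (s.symm.toLinearMap ∘ₗ R)) ?_ inferInstance⟩
  ext x
  exact s.symm_apply_apply x

end ChainComplex

end HomologicalAlgebra

/-! ### Contractibility of the nerve of a category with an initial object -/

section Nerve

open Simplicial SimplicialObject

variable (C : Type) [SmallCategory C]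

/-- The nerve of a category augmented towards a point. -/
def augmentedNerve : SimplicialObject.Augmented Type where
  left := nerve C
  right := PUnit
  hom := { app := fun _ => ↾fun _ => PUnit.unit }

variable {C}

/-- The nerve of a category with an initial object has an extra degeneracy. -/
def augmentedNerveExtraDegeneracy {X : C} (hX : IsInitial X) :
    Augmented.ExtraDegeneracy (augmentedNerve C) where
  s' := ↾fun _ => ComposableArrows.mk₀ X
  s n := ↾fun F : ComposableArrows C n => F.precomp (hX.to _)
  s'_comp_ε := rfl
  s₀_comp_δ₁ := by
    ext F
    exact ComposableArrows.ext₀ rfl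
  s_comp_δ₀ n := rfl
  s_comp_δ n i := by
    ext F
    refine ComposableArrows.ext_succ rfl ?_ (hX.hom_ext _ _)
    exact congrArg (fun f => f (F.precomp (hX.to _)))
      ((nerve C).δ_comp_δ (Fin.zero_le i))
  s_comp_σ n i := by
    ext F
    refine ComposableArrows.ext_succ rfl ?_ (hX.hom_ext _ _)
    exact congrArg (fun f => f (F.precomp (hX.to _)))
      ((nerve C).δ_comp_σ_of_le (Fin.zero_le _))

end Nerve

/-! ### The standard resolution -/

section QuasiIso

variable {k : Type u} [CommRing k] {C : Type} [SmallCategory C]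

/-- A morphism of complexes of functors is a quasi-isomorphism if it is one objectwise. -/
theorem quasiIso_of_evaluation {K L : ChainComplex (C ⥤ ModuleCat.{u} k) ℕ} (φ : K ⟶ L)
    (h : ∀ X : C, QuasiIso ((((evaluation C (ModuleCat.{u} k)).obj X).mapHomologicalComplex
      _).map φ)) : QuasiIso φ := by
  refine ⟨fun n => ?_⟩
  rw [quasiIsoAt_iff, ShortComplex.quasiIso_iff, NatTrans.isIso_iff_isIso_app]
  intro X
  have hX := (h X).quasiIsoAt n
  rw [quasiIsoAt_iff, ShortComplex.quasiIso_iff] at hX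
  exact (NatIso.isIso_map_iff (ShortComplex.homologyFunctorIso
    ((evaluation C (ModuleCat.{u} k)).obj X))
      ((HomologicalComplex.shortComplexFunctor _ _ n).map φ)).1 hX

open Simplicial SimplicialObject AlgebraicTopology

/-- The extra degeneracy makes the augmentation of F applied to S a homotopy equivalence. The rest
compares that complex with F applied to the complex of S; maps to a complex in degree 0 are compared
in degree 0 alone. -/
theorem quasiIso_map_augmentation (F : (C ⥤ ModuleCat.{u} k) ⥤ ModuleCat.{u} k) [F.Additive]
    (S : SimplicialObject.Augmented (C ⥤ ModuleCat.{u} k))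
    (ed : Augmented.ExtraDegeneracy (((Augmented.whiskering _ _).obj F).obj S)) :
    QuasiIso ((F.mapHomologicalComplex _).map (AlternatingFaceMapComplex.ε.app S)) := by
  let e : (F.mapHomologicalComplex _).obj ((alternatingFaceMapComplex _).obj S.left) ≅
      (alternatingFaceMapComplex _).obj (((SimplicialObject.whiskering _ _).obj F).obj S.left) :=
    eqToIso (Functor.congr_obj (map_alternatingFaceMapComplex F) S.left)
  have he : e.hom.f 0 = 𝟙 _ := by
    simp [e, HomologicalComplex.eqToHom_f]
    rfl
  have h : QuasiIso ed.homotopyEquiv.hom := inferInstance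
  let j : (F.mapHomologicalComplex _).obj ((ChainComplex.single₀ _).obj S.right) ≅
      (ChainComplex.single₀ _).obj (F.obj S.right) :=
    (HomologicalComplex.singleMapHomologicalComplex F _ 0).app S.right
  let q : (alternatingFaceMapComplex _).obj
      (((SimplicialObject.whiskering _ _).obj F).obj S.left) ⟶
      (ChainComplex.single₀ _).obj (F.obj S.right) := ed.homotopyEquiv.hom
  have hq : QuasiIso q := h
  let a : (F.mapHomologicalComplex _).obj ((alternatingFaceMapComplex _).obj S.left) ⟶
      (F.mapHomologicalComplex _).obj ((ChainComplex.single₀ _).obj S.right) :=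
    (F.mapHomologicalComplex _).map (AlternatingFaceMapComplex.ε.app S)
  have key : a ≫ j.hom = e.hom ≫ q := by
    apply HomologicalComplex.to_single_hom_ext
    have h1 : a.f 0 = F.map (S.hom.app (op ⦋0⦌)) :=
      congrArg F.map (AlternatingFaceMapComplex.ε_app_f_zero S)
    have h2 : q.f 0 = F.map (S.hom.app (op ⦋0⦌)) :=
      (AlternatingFaceMapComplex.ε_app_f_zero _).trans (Category.comp_id _)
    have h3 : j.hom.f 0 = 𝟙 _ := by
      refine (HomologicalComplex.singleMapHomologicalComplex_hom_app_self F _ 0 _).trans ?_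
      refine (congrArg (· ≫ _) (F.map_id _)).trans ?_
      exact Category.id_comp _
    have hl : a.f 0 ≫ j.hom.f 0 = F.map (S.hom.app (op ⦋0⦌)) := by
      rw [h3, h1]
      exact Category.comp_id _
    have hr : e.hom.f 0 ≫ q.f 0 = F.map (S.hom.app (op ⦋0⦌)) := by
      rw [he, h2]
      exact Category.id_comp _
    exact hl.trans hr.symm
  have h2 : QuasiIso (a ≫ j.hom) := key ▸ inferInstance
  exact (quasiIso_iff_comp_right a j.hom).1 h2

end QuasiIso

section StandardResolution

variable (k : Type u) [CommRing k]

open Simplicial SimplicialObject AlgebraicTopology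

/-- The augmentation of `k[N(- \ ΔS)]`. -/
def standardAugmented : SimplicialObject.Augmented (DeltaSᵒᵖ ⥤ ModuleCat.{u} k) where
  left := standardSimplicial k
  right := (Functor.const _).obj ((uliftFunctor.{u, 0} ⋙ ModuleCat.free k).obj PUnit)
  hom :=
    { app := fun n =>
        { app := fun X => (uliftFunctor.{u, 0} ⋙ ModuleCat.free k).map (↾fun _ => PUnit.unit)
          naturality := fun X Y f =>
            (((uliftFunctor.{u, 0} ⋙ ModuleCat.free k).map_comp _ _).symm.trans rfl).trans
              (Category.comp_id _).symm }
      naturality := fun n m f => by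
        ext X : 2
        exact (((uliftFunctor.{u, 0} ⋙ ModuleCat.free k).map_comp _ _).symm.trans rfl).trans
              (Category.comp_id _).symm }

/-- The augmented simplicial module `k[N(X \ ΔS)]` has an extra degeneracy, since `X` is initial
under itself. -/
def standardExtraDegeneracy (X : DeltaSᵒᵖ) : Augmented.ExtraDegeneracy
    (((Augmented.whiskering _ _).obj ((evaluation DeltaSᵒᵖ (ModuleCat.{u} k)).obj X)).obj
      (standardAugmented k)) :=
  (augmentedNerveExtraDegeneracy (Under.mkIdInitial (X := X.unop))).map
    (uliftFunctor.{u, 0} ⋙ ModuleCat.free k)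

instance quasiIso_standard : QuasiIso (AlternatingFaceMapComplex.ε.app (standardAugmented k)) :=
  quasiIso_of_evaluation _ fun X => quasiIso_map_augmentation _ _ (standardExtraDegeneracy k X)

end StandardResolution

/-! ### The terms of the standard resolution -/

section UnderCategories

variable {C : Type} [SmallCategory C] {n : ℕ}

/-- The canonical lift of a string of arrows `G 0 ⟶ ⋯ ⟶ G n` to the category under `G 0`. -/
def CategoryTheory.ComposableArrows.underLift (G : ComposableArrows C n) :
    ComposableArrows (Under (G.obj 0)) n where
  obj i := Under.mk (G.map (homOfLE (Fin.zero_le i)))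
  map f := Under.homMk (G.map f) (by
    simp only [Under.mk_hom, ← G.map_comp]
    rfl)

/-- A string under X amounts to a string G together with an arrow X ⟶ G 0, and pulling the lift of G
back along this arrow recovers it. This is the Yoneda-type freeness of the standard resolution. -/
theorem CategoryTheory.ComposableArrows.underLift_comp_map {X : C}
    (F : ComposableArrows (Under X) n) :
    ComposableArrows.underLift (F ⋙ Under.forget X) ⋙ Under.map (F.obj 0).hom = F := by
  refine Functor.ext (fun i => ?_) fun i j f => ?_
  · have h := Under.w (F.map (homOfLE (Fin.zero_le i)))
    exact congrArg (fun f => Under.mk f) h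
  · ext
    have key : ∀ {Y Y' Z Z' : Under X} (h : Y = Y') (h' : Z' = Z) (g : Y.right ⟶ Z.right)
        (f : Y' ⟶ Z'), g ≍ f.right → g = (eqToHom h ≫ f ≫ eqToHom h').right := by
      rintro Y _ Z _ rfl rfl g f h
      simpa using eq_of_heq h
    exact key _ _ _ (F.map f) HEq.rfl

end UnderCategories

section StandardTerms

variable {k : Type u} [CommRing k] {n : ℕ}

open Simplicial

/-- The basis element of `k[N(X \ ΔS)]_n` given by a string of arrows under `X`. -/
def standardBasis (k : Type u) [CommRing k] {X : DeltaS} (F : ComposableArrows (Under X) n) :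
    ((standardResolution k).X n).obj (op X) :=
  ModuleCat.freeMk (R := k) (ULift.up.{u} F)

theorem standardResolution_map_basis {X Y : DeltaS} (g : Y ⟶ X)
    (F : ComposableArrows (Under X) n) :
    (((standardResolution k).X n).map g.op).hom (standardBasis k F) =
      standardBasis k (F ⋙ Under.map g) :=
  ModuleCat.free_map_apply _ _

theorem standardResolution_map_underLift {X : DeltaS} (F : ComposableArrows (Under X) n) :
    (((standardResolution k).X n).map (F.obj 0).hom.op).hom
      (standardBasis k (ComposableArrows.underLift (F ⋙ Under.forget X))) =
        standardBasis k F := by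
  refine (standardResolution_map_basis _ _).trans ?_
  exact congrArg _ (ComposableArrows.underLift_comp_map F)

theorem standardResolution_hom_ext {X : DeltaS} {M : Type u} [AddCommGroup M] [Module k M]
    {f g : ((standardResolution k).X n).obj (op X) →ₗ[k] M}
    (h : ∀ F : ComposableArrows (Under X) n, f (standardBasis k F) = g (standardBasis k F)) :
    f = g :=
  congrArg ModuleCat.Hom.hom (ModuleCat.free_hom_ext (f := ModuleCat.ofHom f)
    (g := ModuleCat.ofHom g) fun F => h F.down)

/-- The linear map on `k[N(X \ ΔS)]_n` with prescribed values on the basis. -/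
def standardDesc {X : DeltaS} {M : Type u} [AddCommGroup M] [Module k M]
    (v : ComposableArrows (Under X) n → M) :
    ((standardResolution k).X n).obj (op X) →ₗ[k] M :=
  (ModuleCat.freeDesc (R := k) (M := ModuleCat.of k M) (↾fun F => v F.down)).hom

theorem standardDesc_basis {X : DeltaS} {M : Type u} [AddCommGroup M] [Module k M]
    (v : ComposableArrows (Under X) n → M) (F : ComposableArrows (Under X) n) :
    standardDesc (k := k) v (standardBasis k F) = v F :=
  ModuleCat.freeDesc_apply _ _

/-- The value on a string of arrows under `X` of the natural transformation out of
`k[N(- \ ΔS)]_n` which takes the value `m G` on the canonical lift of `G`. -/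
def standardValue (M : DeltaSᵒᵖ ⥤ ModuleCat.{u} k)
    (m : ∀ G : ComposableArrows DeltaS n, M.obj (op (G.obj 0))) {X : DeltaS}
    (F : ComposableArrows (Under X) n) : M.obj (op X) :=
  (M.map (F.obj 0).hom.op).hom (m (F ⋙ Under.forget X))

theorem standardValue_comp_map (M : DeltaSᵒᵖ ⥤ ModuleCat.{u} k)
    (m : ∀ G : ComposableArrows DeltaS n, M.obj (op (G.obj 0))) {X Y : DeltaS} (g : Y ⟶ X)
    (F : ComposableArrows (Under X) n) :
    standardValue M m (F ⋙ Under.map g) = (M.map g.op).hom (standardValue M m F) :=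
  congrArg (fun t => t.hom (m (F ⋙ Under.forget X))) (M.map_comp (F.obj 0).hom.op g.op)

/-- Natural transformations out of `k[N(- \ ΔS)]_n` with prescribed values on the canonical
lifts. -/
def standardLift (M : DeltaSᵒᵖ ⥤ ModuleCat.{u} k)
    (m : ∀ G : ComposableArrows DeltaS n, M.obj (op (G.obj 0))) :
    (standardResolution k).X n ⟶ M where
  app X := ModuleCat.ofHom (standardDesc (k := k) (X := X.unop) (standardValue M m))
  naturality X Y g := by
    ext1
    refine standardResolution_hom_ext (k := k) (X := X.unop) (M := M.obj Y) fun F => ?_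
    refine (congrArg (standardDesc (k := k) (X := Y.unop) (standardValue M m))
      (standardResolution_map_basis g.unop F)).trans ?_
    refine (standardDesc_basis (k := k) _ _).trans ?_
    refine Eq.trans ?_ (congrArg (M.map g).hom
      (standardDesc_basis (k := k) (standardValue M m) F)).symm
    exact standardValue_comp_map M m g.unop F

theorem standardLift_app_basis (M : DeltaSᵒᵖ ⥤ ModuleCat.{u} k)
    (m : ∀ G : ComposableArrows DeltaS n, M.obj (op (G.obj 0))) {X : DeltaS}
    (F : ComposableArrows (Under X) n) :
    ((standardLift M m).app (op X)).hom (standardBasis k F) = standardValue M m F :=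
  standardDesc_basis (k := k) (standardValue M m) F

theorem standardResolution_app_basis {M : DeltaSᵒᵖ ⥤ ModuleCat.{u} k}
    (f : (standardResolution k).X n ⟶ M) {X : DeltaS} (F : ComposableArrows (Under X) n) :
    (f.app (op X)).hom (standardBasis k F) =
      standardValue M (fun G => (f.app _).hom (standardBasis k G.underLift)) F := by
  rw [← standardResolution_map_underLift F]
  exact congrArg (fun t => t.hom
    (standardBasis k (ComposableArrows.underLift (F ⋙ Under.forget X))))
    (f.naturality (F.obj 0).hom.op)

/-- To lift f along e, choose preimages of its values on the canonical lifts, by objectwise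
surjectivity of e, and extend by naturality. -/
instance projective_standardResolution_X : Projective ((standardResolution k).X n) where
  factors {M M'} f e _ := by
    have he : ∀ X, Function.Surjective (e.app X).hom := fun X =>
      (ModuleCat.epi_iff_surjective _).1 inferInstance
    choose m hm using fun G : ComposableArrows DeltaS n =>
      he (op (G.obj 0)) ((f.app (op (G.obj 0))).hom (standardBasis k G.underLift))
    refine ⟨standardLift M m, ?_⟩
    ext X : 3
    refine standardResolution_hom_ext (k := k) (X := X.unop) fun F => ?_
    refine (congrArg (e.app X).hom (standardLift_app_basis M m F)).trans ?_
    refine Eq.trans ?_ (standardResolution_app_basis f F).symm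
    simp only [← hm]
    exact congrArg (fun t => t.hom (m (F ⋙ Under.forget X.unop)))
      (e.naturality (F.obj 0).hom.op)

variable (k) in
/-- The nerves of the under-categories of `ΔS` give a projective resolution of the constant
functor. -/
def standardProjectiveResolution : ProjectiveResolution ((Functor.const DeltaSᵒᵖ).obj
    ((uliftFunctor.{u, 0} ⋙ ModuleCat.free k).obj PUnit)) where
  complex := standardResolution k
  projective _ := projective_standardResolution_X
  π := AlgebraicTopology.AlternatingFaceMapComplex.ε.app (standardAugmented k)
  quasiIso := quasiIso_standard k

/-- Symmetric homology is the homology of the standard complex. -/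
theorem nonempty_HS_iso (A : Type u) [Ring A] [Algebra k A] (q : ℕ) :
    Nonempty (HS k A q ≅ (symComplex k A).homology q) := by
  let i : ModuleCat.of k k ≅ (uliftFunctor.{u, 0} ⋙ ModuleCat.free k).obj PUnit :=
    (LinearEquiv.symm (Finsupp.uniqueLinearEquiv (R := k) k (ULift.up.{u} PUnit.unit))).toModuleIso
  exact ⟨((tensorOver (symBar k A)).leftDerived q).mapIso
    ((Functor.const DeltaSᵒᵖ).mapIso i) ≪≫
    (standardProjectiveResolution k).isoLeftDerivedObj (tensorOver (symBar k A)) q⟩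

end StandardTerms

/-! ### Terms of the standard complex as retracts -/

section Retract

variable {k : Type u} [CommRing k]

/-- `k[N(- \ ΔS)]_n ⊗_{ΔS} N` is a retract of the direct sum of the values of `N` at the first
objects of the strings of `n` composable arrows of `ΔS`. -/
theorem exists_retract_tensorOver (N : DeltaS ⥤ ModuleCat.{u} k) (n : ℕ) :
    ∃ (i : (tensorOver N).obj ((standardResolution k).X n) →ₗ[k]
          ⨁ G : ComposableArrows DeltaS n, N.obj (G.obj 0))
      (s : (⨁ G : ComposableArrows DeltaS n, N.obj (G.obj 0)) →ₗ[k]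
        (tensorOver N).obj ((standardResolution k).X n)), s ∘ₗ i = LinearMap.id := by
  classical
  let P := (standardResolution k).X n
  let D := ⨁ G : ComposableArrows DeltaS n, N.obj (G.obj 0)
  let i₀ (X : DeltaS) : P.obj (op X) →ₗ[k] N.obj X →ₗ[k] D :=
    standardDesc fun F => DirectSum.lof k _ (fun G : ComposableArrows DeltaS n => N.obj (G.obj 0))
      (F ⋙ Under.forget X) ∘ₗ (N.map (F.obj 0).hom).hom
  have hi₀ : ∀ (X) (F : ComposableArrows (Under X) n), i₀ X (standardBasis k F) =
      DirectSum.lof k _ (fun G : ComposableArrows DeltaS n => N.obj (G.obj 0))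
      (F ⋙ Under.forget X) ∘ₗ (N.map (F.obj 0).hom).hom := fun X F => standardDesc_basis _ F
  let i₁ : (⨁ X : DeltaS, (P.obj (op X) ⊗[k] N.obj X)) →ₗ[k] D :=
    DirectSum.toModule k _ _ fun X => TensorProduct.lift (i₀ X)
  have hi₁ : tensorRelations P N ≤ LinearMap.ker i₁ := by
    refine Submodule.span_le.2 ?_
    rintro _ ⟨X, Y, f, x, y, rfl⟩
    have h : i₀ Y y ((N.map f).hom x) = i₀ X ((P.map f.op).hom y) x := by
      refine LinearMap.congr_fun (f := (LinearMap.applyₗ ((N.map f).hom x)) ∘ₗ i₀ Y)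
        (g := LinearMap.applyₗ x ∘ₗ i₀ X ∘ₗ (P.map f.op).hom) ?_ y
      refine standardResolution_hom_ext fun F => ?_
      have e1 := LinearMap.congr_fun (hi₀ Y F) ((N.map f).hom x)
      have e2 := LinearMap.congr_fun (hi₀ X (F ⋙ Under.map f)) x
      have e3 := congrArg (fun t => i₀ X t x) (standardResolution_map_basis (k := k) f F)
      refine e1.trans (Eq.trans ?_ (e3.trans e2).symm)
      refine congrArg (DirectSum.lof k _ (fun G : ComposableArrows DeltaS n => N.obj (G.obj 0))
        (F ⋙ Under.forget Y)) ?_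
      exact (congrArg (fun t => t.hom x) (N.map_comp f (F.obj 0).hom)).symm
    rw [SetLike.mem_coe, LinearMap.mem_ker, map_sub, sub_eq_zero]
    simpa only [i₁, DirectSum.toModule_lof, TensorProduct.lift.tmul] using h
  let s : D →ₗ[k] (tensorOver N).obj P := DirectSum.toModule k _ _ fun G =>
    (tensorRelations P N).mkQ ∘ₗ
      DirectSum.lof k DeltaS (fun X => P.obj (op X) ⊗[k] N.obj X) (G.obj 0) ∘ₗ
        TensorProduct.mk k _ _ (standardBasis k G.underLift)
  refine ⟨(tensorRelations P N).liftQ i₁ hi₁, s, ?_⟩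
  refine Submodule.linearMap_qext _ (DirectSum.linearMap_ext _ fun X => ?_)
  refine TensorProduct.ext (standardResolution_hom_ext fun F => LinearMap.ext fun a => ?_)
  have e1 : (i₁ (DirectSum.lof k DeltaS (fun X => P.obj (op X) ⊗[k] N.obj X) X
      (standardBasis k F ⊗ₜ[k] a))) =
      DirectSum.lof k _ (fun G : ComposableArrows DeltaS n => N.obj (G.obj 0))
      (F ⋙ Under.forget X) ((N.map (F.obj 0).hom).hom a) := by
    simp only [i₁, DirectSum.toModule_lof, TensorProduct.lift.tmul]
    exact LinearMap.congr_fun (hi₀ X F) a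
  refine (congrArg s e1).trans ?_
  refine (DirectSum.toModule_lof _ _ _).trans ?_
  -- The composite replaces a string under X by its canonical lift and pushes a forward; the
  -- difference from the original tensor is the generating relation of the arrow X ⟶ F 0.
  refine (Submodule.Quotient.eq _).2 (Submodule.subset_span
    ⟨X, (F.obj 0).right, (F.obj 0).hom, a,
      standardBasis k (ComposableArrows.underLift (F ⋙ Under.forget X)), ?_⟩)
  rw [standardResolution_map_underLift]
  rfl

end Retract

/-! ### Flatness and projectivity of tensor powers and of the standard complex -/

section TensorPowers

variable {k : Type u} [CommRing k] (A : Type u) [Ring A] [Algebra k A]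

instance flat_piTensorProduct [Module.Flat k A] (n : ℕ) :
    Module.Flat k (⨂[k] _ : Fin n, A) := by
  induction n with
  | zero => exact Module.Flat.of_linearEquiv (PiTensorProduct.isEmptyEquiv (Fin 0))
  | succ n ih =>
    have : Module.Flat k (⨂[k] _ : Fin 1, A) :=
      Module.Flat.of_linearEquiv (PiTensorProduct.subsingletonEquiv 0)
    exact Module.Flat.of_linearEquiv (TensorPower.mulEquiv (R := k) (M := A) (n := n) (m := 1)).symm

theorem projective_piTensorProduct [Module.Projective k A] (n : ℕ) :
    Module.Projective k (⨂[k] _ : Fin n, A) := by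
  induction n with
  | zero => exact Module.Projective.of_equiv (PiTensorProduct.isEmptyEquiv (Fin 0)).symm
  | succ n ih =>
    have : Module.Projective k (⨂[k] _ : Fin 1, A) :=
      Module.Projective.of_equiv (PiTensorProduct.subsingletonEquiv 0).symm
    exact Module.Projective.of_equiv (TensorPower.mulEquiv (R := k) (M := A) (n := n) (m := 1))

theorem flat_symComplex_X [Module.Flat k A] (n : ℕ) : Module.Flat k ((symComplex k A).X n) := by
  obtain ⟨i, s, h⟩ := exists_retract_tensorOver (symBar k A) n
  have : ∀ X, Module.Flat k ((symBar k A).obj X) := fun X => flat_piTensorProduct A _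
  exact Module.Flat.of_retract i s h

theorem projective_symComplex_X [Module.Projective k A] (n : ℕ) :
    Module.Projective k ((symComplex k A).X n) := by
  obtain ⟨i, s, h⟩ := exists_retract_tensorOver (symBar k A) n
  have : ∀ X, Module.Projective k ((symBar k A).obj X) := fun X => projective_piTensorProduct A _
  exact Module.Projective.of_split i s h

end TensorPowers

end

/-! ### The universal coefficient theorem for symmetric homology -/

theorem mainTheorem9 (k : Type u) [CommRing k] (A : Type u) [Ring A] [Algebra k A]
    [Module.Flat k A] (B : Type u) [CommRing B] [Algebra k B] :
    ∃ (E : HomologicalE2 k)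
      (c : Convergence E (fun n => HSCoeff k A (ModuleCat.of k B) n)),
      (∀ p q : ℕ, Nonempty ((E.page 2).X (p, q) ≅
        ((Tor (ModuleCat.{u} k) p).obj (HS k A q)).obj (ModuleCat.of k B))) ∧
      (HasWeakGlobalDimensionLE k 1 →
        (∃ f : HS k A 0 ⊗ ModuleCat.of k B ⟶ HSCoeff k A (ModuleCat.of k B) 0, IsIso f) ∧
        ∀ n : ℕ,
          ∃ (f : HS k A (n + 1) ⊗ ModuleCat.of k B ⟶ HSCoeff k A (ModuleCat.of k B) (n + 1))
            (g : HSCoeff k A (ModuleCat.of k B) (n + 1) ⟶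
              ((Tor (ModuleCat.{u} k) 1).obj (HS k A n)).obj (ModuleCat.of k B))
            (w : f ≫ g = 0),
            (ShortComplex.mk f g w).ShortExact ∧
            LinearMap.range f.hom = c.F (n + 1) 0 ∧
            (IsHereditaryRing k → Module.Projective k A →
              Nonempty (ShortComplex.mk f g w).Splitting)) := by
  have hflat := flat_symComplex_X (k := k) A
  let R := projectiveResolution (ModuleCat.of k B)
  have hR := R.flat_complex_X
  obtain ⟨c, hc⟩ := TotalTensor.exists_convergence (Y := symComplex k A) (P := R.complex)
    (N := ModuleCat.of k B) (ε := R.augmentation) (w := R.d_augmentation)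
    (fun p n z hz => R.exists_lTensor_augment_d_eq ((symComplex k A).X n) p z hz)
    R.augmentation_surjective
  have hE₂ : ∀ p q : ℕ, Nonempty (((TotalTensor.filtered (symComplex k A)
      R.complex).spectralSequence.page 2).X (p, q) ≅
        ((Tor (ModuleCat.{u} k) p).obj (HS k A q)).obj (ModuleCat.of k B)) := fun p q => by
    obtain ⟨i⟩ := TotalTensor.nonempty_E_two_equiv (symComplex k A) R.complex p q
    obtain ⟨j⟩ := nonempty_HS_iso (k := k) A q
    -- `Tor` is derived in its second argument, so the resolution of B computes it with H_q(Y) fixed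
    -- in the first.
    exact ⟨i.toModuleIso ≪≫ (R.isoLeftDerivedObj ((tensoringLeft (ModuleCat.{u} k)).obj
      ((symComplex k A).homology q)) p).symm ≪≫
        ((Tor (ModuleCat.{u} k) p).mapIso j.symm).app (ModuleCat.of k B)⟩
  refine ⟨_, c, hE₂, fun hk => ?_⟩
  have hE : ∀ p q, 2 ≤ p → IsZero (((TotalTensor.filtered (symComplex k A)
      R.complex).spectralSequence.page 2).X (p, q)) := fun p q hp =>
    (hk _ _ p hp).of_iso (hE₂ p q).some
  have tor₀ : ∀ X : ModuleCat.{u} k, Nonempty (MonoidalCategory.tensorObj X (ModuleCat.of k B) ≅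
    ((Tor (ModuleCat.{u} k) 0).obj X).obj (ModuleCat.of k B)) := fun X =>
    ⟨((Functor.leftDerivedZeroIsoSelf ((tensoringLeft (ModuleCat.{u} k)).obj X)).app _).symm⟩
  refine ⟨c.exists_isIso_zero hE ((tor₀ _).some ≪≫ (hE₂ 0 0).some.symm), fun n => ?_⟩
  obtain ⟨f, g, w, hS, hf⟩ := c.exists_shortExact hE n
    ((tor₀ _).some ≪≫ (hE₂ 0 (n + 1)).some.symm) (hE₂ 1 n).some.symm
  refine ⟨f, g, w, hS, hf, fun hk hA => ?_⟩
  have hproj := projective_symComplex_X (k := k) A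
  obtain ⟨r, hr⟩ := ChainComplex.exists_extend_homologyClass (symComplex k A) hk hproj (n + 1)
  exact ChainComplex.nonempty_splitting (symComplex k A) (ModuleCat.of k B) hr hS (Iso.refl _)
    ((congrArg _ (congrArg _ (Category.comp_id f))).trans (hf.trans (hc (n + 1))))
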